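/- **Setting.** Let $G$ be a finite directed acyclic graph with $n\ge 2$ vertices, let $\rho>1$ be an integer and $0<\gamma<1/2$. Let $H=(V_H,E_H)$ be a subgraph of $G$ in which every vertex has at most $2\rho$ ancestors. For $v\in V_H$, let $A_v$ be the set of ancestors of $v$ in $H$ (including $v$), and for $S\subseteq V_H$ let $A_S=\bigcup_{v\in S}A_v$. Let $E_S$ be the set of edges of $H$ with both endpoints in $A_S$, and $E_v=E_{\{v\}}$. For a set $B$ of vertices, $v$ is *fresh* with respect to $B$ if $|A_v\setminus A_B|>\gamma|A_v|$ and $|E_v\setminus E_B|>\gamma|E_v|$; otherwise it is *stale*. **Estimates.** A run of the estimation procedure on a directed acyclic graph $H'$ draws $r=\lceil\kappa\ln n\rceil$ independent uniformly random hash functions from a strongly 2-universal (pairwise independent) family mapping vertices to $\{1,\dots,n^3\}$, and as many from such a family for edges. For each hash function and each vertex $w$ of $H'$, in topological order, it stores the $t=c/\varepsilon^2$ smallest hash values (with $\varepsilon=1/3$) among the hash value of $w$ and the values stored for the predecessors of $w$ (for edges: among the hash values of the edges entering $w$ and the values stored for the predecessors of $w$). One hash function gives the estimate $t\,n^3/\ell$,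 where $\ell$ is the largest stored value, or the number of stored values if fewer than $t$ are stored; the procedure returns the median over the hash functions. This gives, for every vertex $v$, estimates $a_{H'}(v)$ and $e_{H'}(v)$ of the numbers of ancestors of $v$ in $H'$ and of edges of $H'$ induced by them; both are $0$ if $v$ is not a vertex of $H'$. Every run uses fresh randomness. **FindBatch$(H,\gamma)$.** Let $N=\lceil a\ln n\rceil$, $k=2\lceil\log_2\rho\rceil+2$, and $B=\emptyset$. Run the estimation procedure on $H$ and put the vertices $v$ with $2^i\le e_H(v)<2^{i+1}$ into bucket $K_i$ ($1\le i\le k$); vertices with $e_H(v)<2$ are also put into the smallest bucket $K_1$. While at least one bucket is non-empty, perform the following iteration. 1. (Sampling.) For $i=k,\dots,1$: set $s=0$, and while $s<N$ and $K_i\neq\emptyset$, sample $v$ uniformly from $K_i$ and remove it from $K_i$; if $v$ is fresh with respect to the current $B$, add $v$ to $B$ and set $s=0$; otherwise increase $s$ by $1$. 2. (Pruning.) Run the estimation procedure anew on $H$ and on $H'=H\setminus A_B$, and remove from its bucket every $v$ with $a_{H'}(v)\le 2\gamma\,a_H(v)$ or $e_{H'}(v)\le 2\gamma\,e_H(v)$.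 **Lemma.** With high probability, the outer while loop of FindBatch runs for $O(\ln n)$ iterations before all buckets are empty. Precisely: for every sufficiently large constant $c$, every $d\ge1$, every sufficiently large $\kappa$ (depending on $c,d$) and every $a>0$, there is a constant $C>0$, depending only on $c,d,\kappa,a$, such that for all $G,H,\rho,\gamma$ and hash families as above, with probability at least $1-n^{-d}$ all buckets are empty after at most $C\ln n$ iterations of the outer loop. -/

import Mathlib

/-! ### Directed acyclic graphs, ancestors and ancestor edges -/

/-- A finite directed acyclic graph whose vertices form a subset of the type `V`. -/
structure Dag (V : Type*) where
  verts : Finset V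
  edges : Finset (V × V)
  incident : ∀ e ∈ edges, e.1 ∈ verts ∧ e.2 ∈ verts
  acyclic : ∀ v, ¬ Relation.TransGen (fun a b => (a, b) ∈ edges) v v

namespace Dag

variable {V : Type*}

/-- `H.Adj u v`: there is an edge from `u` to `v`. -/
def Adj (H : Dag V) (u v : V) : Prop := (u, v) ∈ H.edges

theorem adj_wf [Finite V] (H : Dag V) : WellFounded H.Adj := by
  have : Std.Irrefl (Relation.TransGen H.Adj) := ⟨H.acyclic⟩
  have hwf : WellFounded (Relation.TransGen H.Adj) :=
    Finite.wellFounded_of_trans_of_irrefl _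
  exact Subrelation.wf (fun h => Relation.TransGen.single h) hwf

/-- The (immediate) predecessors of `w`. -/
def pred [DecidableEq V] (H : Dag V) (w : V) : Finset V :=
  H.verts.filter fun v => (v, w) ∈ H.edges

open Classical in
/-- The ancestors of `v` in `H`, including `v` itself; this is empty if `v` is not a vertex of
`H`. -/
noncomputable def anc (H : Dag V) (v : V) : Finset V :=
  if v ∈ H.verts then H.verts.filter fun u => Relation.ReflTransGen H.Adj u v else ∅

/-- The ancestors of a set `S` of vertices. -/
noncomputable def ancSet [DecidableEq V] (H : Dag V) (S : Finset V) : Finset V :=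
  S.biUnion H.anc

/-- The edges of the subgraph of `H` induced by the ancestors of the set `S`. -/
noncomputable def ancEdges [DecidableEq V] (H : Dag V) (S : Finset V) : Finset (V × V) :=
  H.edges.filter fun e => e.1 ∈ H.ancSet S ∧ e.2 ∈ H.ancSet S

/-- The graph `H ∖ S`: remove the vertices in `S` and all edges adjacent to them. -/
def remove [DecidableEq V] (H : Dag V) (S : Finset V) : Dag V where
  verts := H.verts \ S
  edges := H.edges.filter fun e => e.1 ∉ S ∧ e.2 ∉ S
  incident := by
    intro e he
    rw [Finset.mem_filter] at he
    have h := H.incident e he.1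
    exact ⟨Finset.mem_sdiff.2 ⟨h.1, he.2.1⟩, Finset.mem_sdiff.2 ⟨h.2, he.2.2⟩⟩
  acyclic := fun v h =>
    H.acyclic v (Relation.TransGen.mono
      (r := fun a b => (a, b) ∈ H.edges.filter fun e => e.1 ∉ S ∧ e.2 ∉ S)
      (fun _ _ hab => (Finset.mem_filter.1 hab).1) v v h)

/-- `H` is a small subgraph for the communication delay `ρ`: every vertex has at most `2ρ`
ancestors. -/
def IsSmall (H : Dag V) (ρ : ℕ) : Prop := ∀ v ∈ H.verts, (H.anc v).card ≤ 2 * ρ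

end Dag

/-! ### The count-distinct estimator -/

/-- A finite family of hash functions `U → [N]`, indexed by seeds, that is (strongly) 2-universal:
for a uniformly random seed, the hash values of any two distinct elements are independent and
uniformly distributed. -/
structure HashFamily (U : Type*) (N : ℕ) where
  Seed : Type
  fintypeSeed : Fintype Seed
  nonemptySeed : Nonempty Seed
  hash : Seed → U → Fin N
  universal : ∀ x y : U, x ≠ y → ∀ i j : Fin N,
    Nat.card {s : Seed // hash s x = i ∧ hash s y = j} * N ^ 2 = Nat.card Seed

attribute [instance] HashFamily.fintypeSeed HashFamily.nonemptySeed

/-- The `t` smallest elements of `T` (all of `T` if it has at most `t` elements). -/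
def smallest (t : ℕ) (T : Finset ℕ) : Finset ℕ :=
  T.filter fun x => (T.filter fun y => y < x).card < t

/-- The sketch of each vertex `w` for one hash function, computed in topological order: insert the
hash values `own w`, merge with the sketches of all predecessors of `w`, and keep the `t` smallest
values. -/
def sketch {V : Type*} [Finite V] [DecidableEq V] (H : Dag V) (t : ℕ) (own : V → Finset ℕ)
    (w : V) : Finset ℕ :=
  if w ∈ H.verts then
    smallest t (own w ∪ (H.pred w).attach.biUnion fun v => sketch H t own v.1)
  else ∅
termination_by H.adj_wf.wrap w
decreasing_by exact (Finset.mem_filter.1 v.2).2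

/-- The cardinality estimate read off from the `t` smallest hash values, the hash values being in
`{1, …, N}`: it is `t * N / ℓ`, where `ℓ` is the largest of the `t` stored values, and simply the
number of stored values if fewer than `t` values are stored. -/
noncomputable def sketchEstimate (t N : ℕ) (T : Finset ℕ) : ℝ :=
  if T.card < t then (T.card : ℝ) else (t : ℝ) * (N : ℝ) / ((T.sup id : ℕ) : ℝ)

/-- The median of `r` real numbers. -/
noncomputable def median {r : ℕ} (x : Fin r → ℝ) : ℝ :=
  ((List.ofFn x).insertionSort (· ≤ ·)).getD (r / 2) 0

/-- The parameters of the estimation procedure for graphs with vertices in `V`: the number `t` of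
hash values stored in a sketch, the number `r` of hash functions, and the 2-universal families from
which the hash functions on vertices and on edges are drawn. -/
structure EstimatorParams (V : Type*) where
  t : ℕ
  r : ℕ
  range : ℕ
  vertexHash : HashFamily V range
  edgeHash : HashFamily (V × V) range

namespace EstimatorParams

variable {V : Type*} [Finite V] [DecidableEq V]

/-- The estimated number of ancestors of `v` in `H`, given the seeds of the hash functions. -/
noncomputable def vertexEstimate (P : EstimatorParams V) (H : Dag V)
    (σ : Fin P.r → P.vertexHash.Seed) (v : V) : ℝ :=
  median fun i => sketchEstimate P.t P.range
    (sketch H P.t (fun w => {(P.vertexHash.hash (σ i) w : ℕ) + 1}) v)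

/-- The estimated number of edges induced by the ancestors of `v` in `H`, given the seeds of the
hash functions. -/
noncomputable def edgeEstimate (P : EstimatorParams V) (H : Dag V)
    (τ : Fin P.r → P.edgeHash.Seed) (v : V) : ℝ :=
  median fun i => sketchEstimate P.t P.range
    (sketch H P.t
      (fun w => (H.pred w).image fun u => (P.edgeHash.hash (τ i) (u, w) : ℕ) + 1) v)

/-- One run of the estimation procedure on `H`, with fresh independent uniformly random hash
functions. It returns the estimated numbers of ancestors and of ancestor edges of all vertices. -/
noncomputable def estimate (P : EstimatorParams V) (H : Dag V) : PMF ((V → ℝ) × (V → ℝ)) :=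
  (PMF.uniformOfFintype (Fin P.r → P.vertexHash.Seed)).bind fun σ =>
    (PMF.uniformOfFintype (Fin P.r → P.edgeHash.Seed)).bind fun τ =>
      PMF.pure (P.vertexEstimate H σ, P.edgeEstimate H τ)

end EstimatorParams

/-! ### The procedure `FindBatch` -/

section FindBatch

variable {V : Type*} [DecidableEq V]

/-- The vertex `v` is fresh with respect to the batch `B` (otherwise it is stale). -/
def IsFresh (H : Dag V) (γ : ℝ) (B : Finset V) (v : V) : Prop :=
  γ * ((H.anc v).card : ℝ) < ((H.anc v \ H.ancSet B).card : ℝ) ∧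
    γ * ((H.ancEdges {v}).card : ℝ) < ((H.ancEdges {v} \ H.ancEdges B).card : ℝ)

/-- The buckets `K i` and the current batch `B`. -/
structure BatchState (V : Type*) where
  K : ℕ → Finset V
  B : Finset V

open Classical in
/-- Inner `while` loop, on the bucket `K` with current batch `B` and with `s` consecutive stale
vertices seen so far: as long as `s < N` and `K` is non-empty, sample `v` uniformly from `K` and
remove it from `K`; if `v` is fresh, then add it to `B` and reset `s`, otherwise increase `s`.
The result is the remaining bucket and the new batch. -/
noncomputable def sampleBucket (H : Dag V) (γ : ℝ) (N : ℕ) (K B : Finset V) (s : ℕ) :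
    PMF (Finset V × Finset V) :=
  if h : s < N ∧ K.Nonempty then
    haveI : Nonempty K := h.2.to_subtype
    (PMF.uniformOfFintype K).bind fun v =>
      if IsFresh H γ B v.1 then sampleBucket H γ N (K.erase v.1) (insert v.1 B) 0
      else sampleBucket H γ N (K.erase v.1) B (s + 1)
  else PMF.pure (K, B)
termination_by K.card
decreasing_by all_goals exact Finset.card_erase_lt_of_mem v.2

/-- The `for` loop: process the buckets `K k, …, K 1` in this order. -/
noncomputable def sampleBuckets (H : Dag V) (γ : ℝ) (N : ℕ) :
    ℕ → BatchState V → PMF (BatchState V)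
  | 0, S => PMF.pure S
  | k + 1, S =>
      (sampleBucket H γ N (S.K (k + 1)) S.B 0).bind fun R =>
        sampleBuckets H γ N k ⟨Function.update S.K (k + 1) R.1, R.2⟩

variable [Finite V]

open Classical in
/-- The procedure `Prune`: estimate in `H` and in `H' = H ∖ A_B`, and remove `v` from its bucket
if one of the two ratios of estimates (in `H'` to in `H`) is at most `2γ`. The comparison is
written without division, so that a vertex without ancestor edges (`0 / 0`) is removed. -/
noncomputable def prune (P : EstimatorParams V) (H : Dag V) (γ : ℝ) (S : BatchState V) :
    PMF (BatchState V) :=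
  (P.estimate H).bind fun e =>
    (P.estimate (H.remove (H.ancSet S.B))).bind fun e' =>
      PMF.pure ⟨fun i => (S.K i).filter fun v =>
        ¬ (e'.1 v ≤ 2 * γ * e.1 v ∨ e'.2 v ≤ 2 * γ * e.2 v), S.B⟩

/-- All buckets `K 1, …, K k` are empty. -/
def AllEmpty (k : ℕ) (S : BatchState V) : Prop := ∀ i ∈ Finset.Icc 1 k, S.K i = ∅

open Classical in
/-- The outer `while` loop (sampling, then pruning, while some bucket is non-empty), interrupted
after at most `T` iterations. -/
noncomputable def whileLoop (P : EstimatorParams V) (H : Dag V) (γ : ℝ) (N k : ℕ) :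
    ℕ → BatchState V → PMF (BatchState V)
  | 0, S => PMF.pure S
  | T + 1, S =>
      if AllEmpty k S then PMF.pure S
      else (sampleBuckets H γ N k S).bind fun S₁ =>
        (prune P H γ S₁).bind fun S₂ => whileLoop P H γ N k T S₂

open Classical in
/-- The initial buckets, given the estimated numbers `e` of ancestor edges:
`K i = {v | 2 ^ i ≤ e v < 2 ^ (i + 1)}`, where the smallest bucket `K 1` also receives the
vertices with `e v < 2` (such as those without proper ancestors). -/
noncomputable def initialBuckets (H : Dag V) (e : V → ℝ) (i : ℕ) : Finset V :=
  H.verts.filter fun v => (i = 1 ∨ (2 : ℝ) ^ i ≤ e v) ∧ e v < (2 : ℝ) ^ (i + 1)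

/-- The number `k = O(log ρ)` of buckets. A vertex with at most `2ρ` ancestors has fewer than
`2ρ²` ancestor edges, so that every estimate with relative error at most `1/3` is below
`4ρ² ≤ 2 ^ k`. -/
def numBuckets (ρ : ℕ) : ℕ := 2 * Nat.clog 2 ρ + 2

/-- `FindBatch(H, γ)`, whose outer `while` loop is interrupted after at most `T` iterations: the
distribution of the state at that time. The uninterrupted loop performs at most `T` iterations
exactly if all buckets are empty in this state. -/
noncomputable def findBatch (P : EstimatorParams V) (H : Dag V) (γ : ℝ) (N k T : ℕ) :
    PMF (BatchState V) :=
  (P.estimate H).bind fun e => whileLoop P H γ N k T ⟨initialBuckets H e.2, ∅⟩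

end FindBatch

/-! ### Sketches -/

/-! The claim is that one iteration shrinks every bucket by a constant factor, except with
polynomially small probability.

Sampling. Let a bucket start an iteration with `M` vertices. While more than `(1 - θ) * M` of the
remaining ones are fresh, a sample is stale with probability at most `θ`, so a given run of `N`
stale samples has probability at most `θ ^ N`. Each fresh sample starts a new run, and there are at
most `M` of them; hence sampling stops with more than `(1 - θ) * M` fresh survivors with probability
at most `2 * M * θ ^ N` (`sampleBucket_le`). Freshness is only lost as the batch grows, so the bound
persists while the other buckets are sampled.

Pruning. If all estimates have relative error at most `1/3`, every stale vertex is removed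
(`prune_stale_le`), so only fresh survivors remain.

Estimates. Sketches are mergeable, so the sketch of a vertex holds the `t` smallest hash values of
its whole ancestor set (`sketch_eq_smallest`). Chebyshev's inequality for pairwise independent hash
values, and Markov's for collisions, bound the failure probability of one hash function by `3/8`;
the median of `r` of them fails with probability at most `(31/32) ^ r`.

Assembly. After `T` good iterations fewer than `(1 - θ) ^ T * n + 1` vertices could remain, in fact
at most `(1 - θ) ^ T * n < 1`. Every iteration removes a vertex, so at most `n` iterations enter the
union bound. Taking `θ = exp (-(d + 6) / a)` makes `θ ^ N` at most `n ^ (-(d + 6))`, and a large `κ`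
does the same for the estimates. -/

theorem smallest_subset (t : ℕ) (T : Finset ℕ) : smallest t T ⊆ T := Finset.filter_subset _ _

theorem smallest_eq_self_of_card_lt {t : ℕ} {T : Finset ℕ} (h : (smallest t T).card < t) :
    smallest t T = T := by
  refine (smallest_subset t T).antisymm ?_
  by_contra hne
  obtain ⟨z, hz, hz'⟩ := Finset.not_subset.1 hne
  have hex : ∃ x, x ∈ T ∧ x ∉ smallest t T := ⟨z, hz, hz'⟩
  classical
  -- For the least omitted element `x`, everything of `T` below `x` is kept, and there are at least
  -- `t` such elements.
  have hx := Nat.find_spec hex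
  have hmin := fun y => Nat.find_min (m := y) hex
  set x := Nat.find hex
  have h1 : t ≤ (T.filter fun y => y < x).card := by
    by_contra h2
    exact hx.2 (Finset.mem_filter.2 ⟨hx.1, not_le.1 h2⟩)
  have h2 : (T.filter fun y => y < x) ⊆ smallest t T := by
    intro y hy
    rw [Finset.mem_filter] at hy
    by_contra h3
    exact hmin y hy.2 ⟨hy.1, h3⟩
  have := Finset.card_le_card h2
  omega

theorem smallest_mono_mem {t : ℕ} {S T : Finset ℕ} (hST : S ⊆ T) {x : ℕ} (hx : x ∈ S)
    (h : x ∈ smallest t T) : x ∈ smallest t S :=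
  Finset.mem_filter.2 ⟨hx, lt_of_le_of_lt
    (Finset.card_le_card (Finset.filter_subset_filter _ hST)) (Finset.mem_filter.1 h).2⟩

/-- This is why sketches can be merged. If `t` elements of `T` lay below `x`, the `t` smallest of
them would be among the `t` smallest of `T`, hence in `S`, and `x` could not be kept in `S` either.
-/
theorem smallest_eq_of_subset {t : ℕ} {S T : Finset ℕ} (h1 : smallest t T ⊆ S) (h2 : S ⊆ T) :
    smallest t S = smallest t T := by
  ext x
  refine ⟨fun hx => ?_, fun hx => smallest_mono_mem h2 (h1 hx) hx⟩
  have hxS := (Finset.mem_filter.1 hx).2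
  refine Finset.mem_filter.2 ⟨h2 (smallest_subset _ _ hx), ?_⟩
  by_contra hcard
  set L := T.filter fun y => y < x
  have hL : t ≤ (smallest t L).card := by
    by_contra h3
    rw [smallest_eq_self_of_card_lt (not_le.1 h3)] at h3
    exact hcard (not_le.1 h3)
  have hsub : smallest t L ⊆ S.filter fun y => y < x := by
    intro y hy
    have hyL := Finset.mem_filter.1 (smallest_subset _ _ hy)
    refine Finset.mem_filter.2 ⟨h1 (Finset.mem_filter.2 ⟨hyL.1, ?_⟩), hyL.2⟩
    refine lt_of_le_of_lt (Finset.card_le_card ?_) (Finset.mem_filter.1 hy).2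
    intro z hz
    rw [Finset.mem_filter] at hz ⊢
    exact ⟨Finset.mem_filter.2 ⟨hz.1, hz.2.trans hyL.2⟩, hz.2⟩
  have := Finset.card_le_card hsub
  omega

theorem smallest_union_biUnion {ι : Type*} (t : ℕ) (A : Finset ℕ) (s : Finset ι)
    (f g : ι → Finset ℕ) (h : ∀ i ∈ s, f i = smallest t (g i)) :
    smallest t (A ∪ s.biUnion f) = smallest t (A ∪ s.biUnion g) := by
  apply smallest_eq_of_subset
  · intro x hx
    rcases Finset.mem_union.1 (smallest_subset _ _ hx) with h1 | h1
    · exact Finset.mem_union_left _ h1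
    · obtain ⟨i, hi, hxi⟩ := Finset.mem_biUnion.1 h1
      refine Finset.mem_union_right _ (Finset.mem_biUnion.2 ⟨i, hi, ?_⟩)
      rw [h i hi]
      refine smallest_mono_mem (fun y hy => ?_) hxi hx
      exact Finset.mem_union_right _ (Finset.mem_biUnion.2 ⟨i, hi, hy⟩)
  · refine Finset.union_subset_union_right fun x hx => ?_
    obtain ⟨i, hi, hxi⟩ := Finset.mem_biUnion.1 hx
    rw [h i hi] at hxi
    exact Finset.mem_biUnion.2 ⟨i, hi, smallest_subset _ _ hxi⟩

/-! ### Ancestor sets, their induced edges, and removal of vertices. -/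

namespace Dag

variable {V : Type*}

theorem mem_anc {H : Dag V} {u v : V} :
    u ∈ H.anc v ↔ v ∈ H.verts ∧ u ∈ H.verts ∧ Relation.ReflTransGen H.Adj u v := by
  unfold anc
  split_ifs with h <;> simp [h]

theorem anc_eq_union [DecidableEq V] {H : Dag V} {w : V} (hw : w ∈ H.verts) :
    H.anc w = {w} ∪ (H.pred w).biUnion H.anc := by
  ext u
  simp only [Finset.mem_union, Finset.mem_singleton, Finset.mem_biUnion, mem_anc, pred,
    Finset.mem_filter]
  constructor
  · rintro ⟨-, hu, h⟩
    rcases Relation.ReflTransGen.cases_tail h with h | ⟨v, hv, hvw⟩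
    · exact Or.inl h.symm
    · have := (H.incident _ hvw).1
      exact Or.inr ⟨v, ⟨this, hvw⟩, this, hu, hv⟩
  · rintro (rfl | ⟨v, ⟨hv, hvw⟩, -, hu, h⟩)
    · exact ⟨hw, hw, Relation.ReflTransGen.refl⟩
    · exact ⟨hw, hu, h.tail hvw⟩

/-- Ancestor sets are closed under predecessors, so an edge is induced as soon as its head is an
ancestor. Inserting each edge at its head therefore makes the sketch see exactly the induced edges.
-/
theorem ancEdges_singleton [DecidableEq V] (H : Dag V) (v : V) :
    H.ancEdges {v} = (H.anc v).biUnion fun w => (H.pred w).image fun u => (u, w) := by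
  ext ⟨x, y⟩
  simp only [ancEdges, ancSet, Finset.singleton_biUnion, Finset.mem_filter, Finset.mem_biUnion,
    Finset.mem_image, Prod.mk.injEq, pred]
  constructor
  · rintro ⟨h, -, hy⟩
    exact ⟨y, hy, x, ⟨(H.incident _ h).1, h⟩, rfl, rfl⟩
  · rintro ⟨y, hy, x, ⟨hx, h⟩, rfl, rfl⟩
    have := mem_anc.1 hy
    exact ⟨h, mem_anc.2 ⟨this.1, hx, Relation.ReflTransGen.head h this.2.2⟩, hy⟩

theorem anc_remove_subset [DecidableEq V] (H : Dag V) (S : Finset V) (v : V) :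
    (H.remove S).anc v ⊆ H.anc v \ S := by
  intro u hu
  obtain ⟨hv, hu, h⟩ := mem_anc.1 hu
  rw [remove, Finset.mem_sdiff] at hv hu
  refine Finset.mem_sdiff.2 ⟨mem_anc.2 ⟨hv.1, hu.1, ?_⟩, hu.2⟩
  exact Relation.ReflTransGen.mono (fun a b hab => (Finset.mem_filter.1 hab).1) _ _ h

theorem ancEdges_remove_subset [DecidableEq V] (H : Dag V) (B : Finset V) (v : V) :
    (H.remove (H.ancSet B)).ancEdges {v} ⊆ H.ancEdges {v} \ H.ancEdges B := by
  intro e he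
  simp only [ancEdges, ancSet, Finset.singleton_biUnion, Finset.mem_filter,
    Finset.mem_sdiff] at he ⊢
  obtain ⟨he, h1, h2⟩ := he
  have h1' := Finset.mem_sdiff.1 (anc_remove_subset _ _ _ h1)
  have h2' := Finset.mem_sdiff.1 (anc_remove_subset _ _ _ h2)
  exact ⟨⟨(Finset.mem_filter.1 he).1, h1'.1, h2'.1⟩, fun h => h1'.2 (Finset.mem_filter.1 h).2.1⟩

theorem not_adj_symm {H : Dag V} {u v : V} (h : H.Adj u v) : ¬ H.Adj v u := fun h' =>
  H.acyclic u ((Relation.TransGen.single h).tail h')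

theorem not_adj_self {H : Dag V} {u : V} : ¬ H.Adj u u := fun h =>
  H.acyclic u (Relation.TransGen.single h)

/-- By acyclicity the edge set is disjoint from its reversal, and both avoid the diagonal. The
factor 2 is what lets a range of size `n ^ 3` suffice for small `n` in `eight_mul_card_ancEdges_le`.
-/
theorem two_mul_card_edges_le [Fintype V] [DecidableEq V] (H : Dag V) :
    2 * H.edges.card ≤ Fintype.card V * (Fintype.card V - 1) := by
  have hdisj : Disjoint H.edges (H.edges.image Prod.swap) := by
    rw [Finset.disjoint_left]
    rintro ⟨x, y⟩ h1 h2
    obtain ⟨⟨x', y'⟩, h3, h4⟩ := Finset.mem_image.1 h2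
    cases h4
    exact H.not_adj_symm h1 h3
  have hsub : H.edges ∪ H.edges.image Prod.swap ⊆ (Finset.univ : Finset V).offDiag := by
    rintro ⟨x, y⟩ h
    rw [Finset.mem_offDiag]
    refine ⟨Finset.mem_univ _, Finset.mem_univ _, fun hxy => ?_⟩
    obtain rfl : x = y := hxy
    rcases Finset.mem_union.1 h with h | h
    · exact H.not_adj_self h
    · obtain ⟨⟨x', y'⟩, h3, h4⟩ := Finset.mem_image.1 h
      cases h4
      exact H.not_adj_self h3
  have h := Finset.card_le_card hsub
  rw [Finset.card_union_of_disjoint hdisj,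
    Finset.card_image_of_injective _ Prod.swap_injective, Finset.offDiag_card,
    Finset.card_univ, ← Nat.mul_sub_one] at h
  omega

end Dag

theorem sketch_eq_smallest {V : Type*} [Finite V] [DecidableEq V] (H : Dag V) (t : ℕ)
    (own : V → Finset ℕ) (w : V) : sketch H t own w = smallest t ((H.anc w).biUnion own) := by
  induction w using H.adj_wf.induction with
  | _ w ih =>
    rw [sketch]
    split_ifs with hw
    · rw [smallest_union_biUnion t (own w) (H.pred w).attach _
        (fun v => (H.anc v.1).biUnion own) fun v _ => ih v.1 (Finset.mem_filter.1 v.2).2]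
      rw [Dag.anc_eq_union hw, Finset.union_biUnion, Finset.singleton_biUnion,
        Finset.biUnion_biUnion]
      congr 2
      ext x
      simp
    · simp [Dag.anc, hw, smallest]

theorem sketchEstimate_of_card_lt {t N : ℕ} {T : Finset ℕ} (h : (smallest t T).card < t) :
    sketchEstimate t N (smallest t T) = T.card := by
  rw [sketchEstimate, if_pos h, smallest_eq_self_of_card_lt h]

/-- If the sketch is full, then the estimate is `t * N / ℓ`, where `ℓ` is the `t`-th smallest
value. -/
theorem exists_sketchEstimate_eq {t : ℕ} (N : ℕ) {T : Finset ℕ} (ht : 0 < t)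
    (h : t ≤ (smallest t T).card) : ∃ l ∈ T, sketchEstimate t N (smallest t T) = t * N / (l : ℝ) ∧
      t ≤ (T.filter fun y => y ≤ l).card ∧ (T.filter fun y => y < l).card < t := by
  have hne : (smallest t T).Nonempty := Finset.card_pos.1 (by omega)
  obtain ⟨l, hl, hsup⟩ := Finset.exists_mem_eq_sup _ hne (id : ℕ → ℕ)
  refine ⟨l, smallest_subset _ _ hl, ?_, ?_, (Finset.mem_filter.1 hl).2⟩
  · rw [sketchEstimate, if_neg (by omega), hsup, id]
  · refine h.trans (Finset.card_le_card fun y hy => ?_)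
    refine Finset.mem_filter.2 ⟨smallest_subset _ _ hy, ?_⟩
    have := Finset.le_sup (f := (id : ℕ → ℕ)) hy
    rw [hsup] at this
    exact this

/-! ### Medians -/

theorem median_eq_sort {r : ℕ} (x : Fin r → ℝ) (h : r / 2 < r) :
    median x = x (Tuple.sort x ⟨r / 2, h⟩) := by
  have h1 : (List.ofFn x).insertionSort (· ≤ ·) = List.ofFn (x ∘ Tuple.sort x) := by
    refine List.Perm.eq_of_pairwise' (List.pairwise_insertionSort _ _) ?_
      ((List.perm_insertionSort _ _).trans ((Tuple.sort x).ofFn_comp_perm x).symm)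
    exact (List.sortedLE_ofFn_iff.2 (Tuple.monotone_sort x)).pairwise
  rw [median, h1, List.getD_eq_getElem _ _ (by simpa using h)]
  simp

/-- If more than half of the numbers lie in an interval, then so does the median. -/
theorem median_mem_Icc {r : ℕ} {x : Fin r → ℝ} {lo hi : ℝ}
    (h : 2 * (Finset.univ.filter fun i => x i ∉ Set.Icc lo hi).card < r) :
    median x ∈ Set.Icc lo hi := by
  have hr : r / 2 < r := by omega
  set τ := Tuple.sort x
  have hmono : Monotone (x ∘ τ) := Tuple.monotone_sort x
  rw [median_eq_sort x hr]
  -- A median outside the interval puts all sorted entries on one side of index `r / 2`, that index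
  -- included, outside as well; either way these are at least half of all entries.
  have key : ∀ s : Finset (Fin r), (∀ i ∈ s, x (τ i) ∉ Set.Icc lo hi) → 2 * s.card < r := by
    intro s hs
    refine lt_of_le_of_lt (Nat.mul_le_mul_left 2 ?_) h
    rw [← Finset.card_map τ.toEmbedding]
    refine Finset.card_le_card fun i hi => ?_
    obtain ⟨j, hj, rfl⟩ := Finset.mem_map.1 hi
    exact Finset.mem_filter.2 ⟨Finset.mem_univ _, hs j hj⟩
  constructor
  · by_contra hlt
    have := key (Finset.Iic ⟨r / 2, hr⟩) fun i hi hmem =>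
      hlt (hmem.1.trans (hmono (Finset.mem_Iic.1 hi)))
    rw [Fin.card_Iic] at this
    simp only at this
    omega
  · by_contra hlt
    have := key (Finset.Ici ⟨r / 2, hr⟩) fun i hi hmem =>
      hlt ((hmono (Finset.mem_Ici.1 hi)).trans hmem.2)
    rw [Fin.card_Ici] at this
    simp only at this
    omega

/-! ### Moments of pairwise independent hash values -/

namespace HashFamily

open Classical in
-- Universality summed over the pairs in `P`; all later counts of seeds come from a suitable `P`.
-- Probabilities are kept as integer counts with denominators cleared.
theorem card_hash_mem {U : Type*} {N : ℕ} (F : HashFamily U N) {x y : U} (hxy : x ≠ y)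
    (P : Finset (Fin N × Fin N)) :
    (Finset.univ.filter fun s => (F.hash s x, F.hash s y) ∈ P).card * N ^ 2 =
      P.card * Fintype.card F.Seed := by
  have hmaps : Set.MapsTo (fun s => (F.hash s x, F.hash s y))
      (Finset.univ.filter fun s => (F.hash s x, F.hash s y) ∈ P) P :=
    fun s hs => (Finset.mem_filter.1 hs).2
  rw [Finset.card_eq_sum_card_fiberwise hmaps, Finset.sum_mul, Finset.card_eq_sum_ones,
    Finset.sum_mul]
  refine Finset.sum_congr rfl fun ij hij => ?_
  rw [one_mul, ← Nat.card_eq_fintype_card, ← F.universal x y hxy ij.1 ij.2]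
  congr 1
  rw [Nat.card_eq_fintype_card, Fintype.card_subtype, Finset.filter_filter]
  congr 1
  ext s
  simp only [Finset.mem_filter, Finset.mem_univ, true_and]
  constructor
  · rintro ⟨-, h⟩
    exact ⟨congrArg Prod.fst h, congrArg Prod.snd h⟩
  · rintro ⟨h1, h2⟩
    have : (F.hash s x, F.hash s y) = ij := Prod.ext h1 h2
    exact ⟨this ▸ hij, this⟩

theorem range_pos {U : Type*} {N : ℕ} (F : HashFamily U N) [Nonempty U] : 0 < N := by
  obtain ⟨s⟩ := F.nonemptySeed
  obtain ⟨x⟩ := ‹Nonempty U›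
  exact Fin.pos (F.hash s x)

theorem card_filter_val_lt {N k : ℕ} (hk : k ≤ N) :
    (Finset.univ.filter fun i : Fin N => (i : ℕ) < k).card = k := by
  rw [← Finset.card_map Fin.valEmbedding]
  convert Finset.card_range k
  ext i
  simp only [Finset.mem_map, Finset.mem_filter, Finset.mem_univ, true_and, Fin.valEmbedding_apply,
    Finset.mem_range]
  exact ⟨fun ⟨j, hj, h⟩ => h ▸ hj, fun h => ⟨⟨i, h.trans_le hk⟩, h, rfl⟩⟩

variable {U : Type*} {N : ℕ} (F : HashFamily U N)

theorem card_hash_lt_pair {x y : U} (hxy : x ≠ y) {k : ℕ} (hk : k ≤ N) :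
    (Finset.univ.filter fun s => (F.hash s x : ℕ) < k ∧ (F.hash s y : ℕ) < k).card * N ^ 2 =
      k ^ 2 * Fintype.card F.Seed := by
  have h := F.card_hash_mem hxy
    ((Finset.univ.filter fun i : Fin N => (i : ℕ) < k) ×ˢ
      (Finset.univ.filter fun i : Fin N => (i : ℕ) < k))
  rw [Finset.card_product, card_filter_val_lt hk, ← sq] at h
  simpa using h

/-- Universality only speaks of pairs, so the distribution of one hash value is a marginal and needs
a second element `y`. -/
theorem card_hash_lt [Nontrivial U] (x : U) {k : ℕ} (hk : k ≤ N) :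
    (Finset.univ.filter fun s => (F.hash s x : ℕ) < k).card * N = k * Fintype.card F.Seed := by
  obtain ⟨y, hy⟩ := exists_ne x
  have h := F.card_hash_mem hy.symm
    ((Finset.univ.filter fun i : Fin N => (i : ℕ) < k) ×ˢ Finset.univ)
  rw [Finset.card_product, card_filter_val_lt hk, Finset.card_univ, Fintype.card_fin] at h
  refine Nat.eq_of_mul_eq_mul_right F.range_pos ?_
  rw [mul_assoc, ← sq, mul_right_comm]
  simpa using h

theorem card_hash_eq_lt {x y : U} (hxy : x ≠ y) {k : ℕ} (hk : k ≤ N) :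
    (Finset.univ.filter fun s => F.hash s x = F.hash s y ∧ (F.hash s x : ℕ) < k).card * N ^ 2 =
      k * Fintype.card F.Seed := by
  have h := F.card_hash_mem hxy
    ((Finset.univ.filter fun i : Fin N => (i : ℕ) < k).image fun i => (i, i))
  rw [Finset.card_image_of_injective _ (fun i j hij => congrArg Prod.fst hij),
    card_filter_val_lt hk] at h
  rw [← h]
  congr 2
  ext s
  simp only [Finset.mem_filter, Finset.mem_univ, true_and, Finset.mem_image, Prod.mk.injEq]
  constructor
  · rintro ⟨h1, h2⟩
    exact ⟨_, h2, rfl, h1⟩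
  · rintro ⟨i, h1, h2, h3⟩
    exact ⟨h2.symm.trans h3, h2 ▸ h1⟩

/-- The number of elements of `A` with hash value less than `k`. -/
def countLt (A : Finset U) (k : ℕ) (s : F.Seed) : ℕ := (A.filter fun x => (F.hash s x : ℕ) < k).card

/-- The number of ordered pairs of distinct elements of `A` whose hash values are equal and less
than `k`. -/
def collisionsLt [DecidableEq U] (A : Finset U) (k : ℕ) (s : F.Seed) : ℕ :=
  (A.offDiag.filter fun e => F.hash s e.1 = F.hash s e.2 ∧ (F.hash s e.1 : ℕ) < k).card

theorem sum_card_filter_comm {α β : Type*} [Fintype α] (A : Finset β) (p : α → β → Prop)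
    [∀ a b, Decidable (p a b)] :
    ∑ a, (A.filter fun b => p a b).card = ∑ b ∈ A, (Finset.univ.filter fun a => p a b).card := by
  simp only [Finset.card_filter]
  exact Finset.sum_comm

theorem sum_countLt [Nontrivial U] (A : Finset U) {k : ℕ} (hk : k ≤ N) :
    (∑ s, F.countLt A k s) * N = A.card * k * Fintype.card F.Seed := by
  unfold countLt
  rw [sum_card_filter_comm, Finset.sum_mul, Finset.sum_congr rfl fun x _ => F.card_hash_lt x hk,
    Finset.sum_const, smul_eq_mul, mul_assoc]

theorem sum_collisionsLt [DecidableEq U] (A : Finset U) {k : ℕ} (hk : k ≤ N) :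
    (∑ s, F.collisionsLt A k s) * N ^ 2 =
      A.card * (A.card - 1) * k * Fintype.card F.Seed := by
  unfold collisionsLt
  rw [sum_card_filter_comm, Finset.sum_mul, Finset.sum_congr rfl fun e he =>
    F.card_hash_eq_lt (Finset.mem_offDiag.1 he).2.2 hk, Finset.sum_const, smul_eq_mul,
    Finset.offDiag_card, Nat.mul_sub_one, mul_assoc _ k]

theorem countLt_sq (A : Finset U) (k : ℕ) (s : F.Seed) : F.countLt A k s ^ 2 = F.countLt A k s +
    (A.offDiag.filter fun e => (F.hash s e.1 : ℕ) < k ∧ (F.hash s e.2 : ℕ) < k).card := by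
  set B := A.filter fun x => (F.hash s x : ℕ) < k with hB
  have h1 : (A.offDiag.filter fun e => (F.hash s e.1 : ℕ) < k ∧ (F.hash s e.2 : ℕ) < k)
      = B.offDiag := by
    ext e
    simp only [hB, Finset.mem_filter, Finset.mem_offDiag]
    tauto
  rw [h1, Finset.offDiag_card, sq, countLt, ← hB]
  have := Nat.le_mul_self B.card
  omega

theorem sum_countLt_sq [Nontrivial U] (A : Finset U) {k : ℕ} (hk : k ≤ N) :
    (∑ s, F.countLt A k s ^ 2) * N ^ 2 =
      (A.card * k * N + A.card * (A.card - 1) * k ^ 2) * Fintype.card F.Seed := by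
  simp only [countLt_sq]
  rw [Finset.sum_add_distrib, sum_card_filter_comm, add_mul, Finset.sum_mul A.offDiag, Finset.sum_congr rfl
    fun e he => F.card_hash_lt_pair (Finset.mem_offDiag.1 he).2.2 hk, Finset.sum_const, smul_eq_mul,
    Finset.offDiag_card, ← Nat.mul_sub_one, sq N, ← mul_assoc, F.sum_countLt A hk]
  ring

/-- Pairwise independence makes the variance `m p - m p ^ 2`, with `m = A.card` and `p = k / N`;
this is at most the mean `m p`. -/
theorem sum_sub_sq_le [Nontrivial U] (A : Finset U) {k : ℕ} (hk : k ≤ N) :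
    ∑ s, ((F.countLt A k s : ℝ) - A.card * k / N) ^ 2 ≤
      A.card * k / N * Fintype.card F.Seed := by
  have hN : (0 : ℝ) < N := by exact_mod_cast F.range_pos
  have h1 : (∑ s, (F.countLt A k s : ℝ)) * N = A.card * k * Fintype.card F.Seed := by
    exact_mod_cast F.sum_countLt A hk
  have h2 : (∑ s, (F.countLt A k s : ℝ) ^ 2) * N ^ 2 =
      (A.card * k * N + A.card * (A.card - 1) * k ^ 2) * Fintype.card F.Seed := by
    rcases Nat.eq_zero_or_pos A.card with h | h
    · simp [countLt, Finset.card_eq_zero.1 h]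
    · have := F.sum_countLt_sq A hk
      rw [← Nat.cast_pred h]
      exact_mod_cast this
  simp only [sub_sq, Finset.sum_add_distrib, Finset.sum_sub_distrib, ← Finset.sum_mul,
    ← Finset.mul_sum, Finset.sum_const, nsmul_eq_mul, Finset.card_univ]
  rw [← eq_div_iff (by positivity)] at h1 h2
  rw [h1, h2]
  have h3 : (0 : ℝ) ≤ A.card * k ^ 2 / N ^ 2 * Fintype.card F.Seed := by positivity
  refine le_of_sub_nonneg (h3.trans_eq ?_)
  field_simp
  ring

theorem card_mul_le_sum {α : Type*} [Fintype α] (p : α → Prop) [DecidablePred p] (f : α → ℝ)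
    {b : ℝ} (hf : ∀ a, 0 ≤ f a) (h : ∀ a, p a → b ≤ f a) :
    ((Finset.univ.filter p).card : ℝ) * b ≤ ∑ a, f a := by
  rw [← nsmul_eq_mul, ← Finset.sum_const]
  refine (Finset.sum_le_sum fun a ha => h a (Finset.mem_filter.1 ha).2).trans ?_
  exact Finset.sum_le_sum_of_subset_of_nonneg (Finset.filter_subset _ _) fun a _ _ => hf a

/-- Chebyshev's inequality for the number of elements with small hash values. -/
theorem chebyshev [Nontrivial U] (A : Finset U) {k : ℕ} (hk : k ≤ N) (p : F.Seed → Prop)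
    [DecidablePred p] {b : ℝ} (hb : 0 ≤ b)
    (h : ∀ s, p s → b ≤ |(F.countLt A k s : ℝ) - A.card * k / N|) :
    ((Finset.univ.filter p).card : ℝ) * b ^ 2 ≤ A.card * k / N * Fintype.card F.Seed := by
  refine (card_mul_le_sum p _ (fun s => sq_nonneg _) fun s hs => ?_).trans
    (F.sum_sub_sq_le A hk)
  rw [← sq_abs ((F.countLt A k s : ℝ) - _)]
  exact pow_le_pow_left₀ hb (h s hs) 2

/-- Markov's inequality for the number of collisions. -/
theorem markov_collisions [DecidableEq U] [Nonempty U] (A : Finset U) (hA : 8 * (A.card - 1) ≤ N) {k : ℕ}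
    (hk : k ≤ N)
    (p : F.Seed → Prop) [DecidablePred p] {b : ℝ}
    (h : ∀ s, p s → b ≤ (F.collisionsLt A k s : ℝ)) :
    ((Finset.univ.filter p).card : ℝ) * b ≤ A.card * k / N / 8 * Fintype.card F.Seed := by
  refine (card_mul_le_sum p (fun s => (F.collisionsLt A k s : ℝ)) (fun s => Nat.cast_nonneg _)
    h).trans ?_
  have hN : (0 : ℝ) < N := by exact_mod_cast F.range_pos
  have h1 : (∑ s, (F.collisionsLt A k s : ℝ)) * N ^ 2 =
      A.card * (A.card - 1 : ℕ) * k * Fintype.card F.Seed := by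
    exact_mod_cast F.sum_collisionsLt A hk
  rw [← eq_div_iff (by positivity)] at h1
  rw [h1, div_le_iff₀ (by positivity)]
  have h2 : (8 : ℝ) * (A.card - 1 : ℕ) ≤ N := by exact_mod_cast hA
  have h3 : (A.card : ℝ) * k / N / 8 * Fintype.card F.Seed * N ^ 2
      = A.card * k * Fintype.card F.Seed / 8 * N := by
    field_simp
  rw [h3]
  have h4 : (0 : ℝ) ≤ A.card * k * Fintype.card F.Seed / 8 := by positivity
  nlinarith [mul_le_mul_of_nonneg_left h2 h4]

/-- The number of distinct hash values less than `k` is at least the number of elements with such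
hash values minus the number of colliding pairs. -/
theorem countLt_le [DecidableEq U] (A : Finset U) (k : ℕ) (s : F.Seed) :
    2 * F.countLt A k s ≤
      2 * ((A.image fun x => (F.hash s x : ℕ) + 1).filter fun y => y ≤ k).card +
        F.collisionsLt A k s := by
  set B := A.filter fun x => (F.hash s x : ℕ) < k with hB
  have himage : (A.image fun x => (F.hash s x : ℕ) + 1).filter (fun y => y ≤ k) =
      B.image fun x => (F.hash s x : ℕ) + 1 := by
    rw [Finset.filter_image]
    rfl
  have hoff : F.collisionsLt A k s =
      (B.offDiag.filter fun e => (F.hash s e.1 : ℕ) + 1 = (F.hash s e.2 : ℕ) + 1).card := by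
    rw [collisionsLt]
    congr 1
    ext e
    simp only [hB, Finset.mem_filter, Finset.mem_offDiag, Fin.ext_iff, add_left_inj]
    constructor
    · rintro ⟨⟨h1, h2, h3⟩, h4, h5⟩
      exact ⟨⟨⟨h1, h5⟩, ⟨h2, h4 ▸ h5⟩, h3⟩, h4⟩
    · rintro ⟨⟨⟨h1, h5⟩, ⟨h2, -⟩, h3⟩, h4⟩
      exact ⟨⟨h1, h2, h3⟩, h4, h5⟩
  rw [himage, hoff, countLt, ← hB]
  change _ ≤ _ + (B.offDiag.filter fun e => (fun x => (F.hash s x : ℕ) + 1) e.1 =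
    (fun x => (F.hash s x : ℕ) + 1) e.2).card
  generalize (fun x => (F.hash s x : ℕ) + 1) = g
  have h1 : (B.offDiag.filter fun e => g e.1 = g e.2).card =
      ∑ y ∈ B.image g, (B.filter fun x => g x = y).offDiag.card := by
    rw [Finset.card_eq_sum_card_fiberwise (f := fun e => g e.1) (t := B.image g)]
    · refine Finset.sum_congr rfl fun y _ => congrArg _ ?_
      ext e
      simp only [Finset.mem_filter, Finset.mem_offDiag]
      constructor
      · rintro ⟨⟨⟨h1, h2, h3⟩, h4⟩, h5⟩
        exact ⟨⟨h1, h5⟩, ⟨h2, h4 ▸ h5⟩, h3⟩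
      · rintro ⟨⟨h1, h5⟩, ⟨h2, h4⟩, h3⟩
        exact ⟨⟨⟨h1, h2, h3⟩, h5.trans h4.symm⟩, h5⟩
    · intro e he
      have := Finset.mem_offDiag.1 (Finset.mem_filter.1 he).1
      exact Finset.mem_image_of_mem g this.1
  rw [h1, Finset.card_eq_sum_card_image g B, Finset.card_eq_sum_ones (B.image g), Finset.mul_sum,
    Finset.mul_sum, ← Finset.sum_add_distrib]
  -- A value with `j ≥ 1` preimages loses `j - 1` in the count of distinct values and gives `j * (j
  -- - 1)` ordered collisions, so `2 * j ≤ 2 + j * (j - 1)` is all that is needed.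
  refine Finset.sum_le_sum fun y hy => ?_
  rw [Finset.offDiag_card]
  generalize (B.filter fun x => g x = y).card = j
  rcases Nat.lt_or_ge j 2 with hj | hj
  · interval_cases j <;> simp
  · have : 2 * j ≤ j * j := Nat.mul_le_mul_right j hj
    rcases Nat.lt_or_ge j 3 with hj3 | hj3
    · interval_cases j; simp
    · have : 3 * j ≤ j * j := Nat.mul_le_mul_right j hj3
      omega

end HashFamily

/-! ### Accuracy of the estimate of one hash function -/

namespace HashFamily

variable {U : Type*} {N : ℕ} (F : HashFamily U N)

/-- The set of hash values of the elements of `A`, the values being in `{1, …, N}`. -/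
def values (A : Finset U) (s : F.Seed) : Finset ℕ := A.image fun x => (F.hash s x : ℕ) + 1

theorem card_values_le (A : Finset U) (s : F.Seed) : (F.values A s).card ≤ A.card :=
  Finset.card_image_le

theorem mem_values_bounds {A : Finset U} {s : F.Seed} {l : ℕ} (hl : l ∈ F.values A s) :
    0 < l ∧ l ≤ N := by
  obtain ⟨x, -, rfl⟩ := Finset.mem_image.1 hl
  exact ⟨Nat.succ_pos _, (F.hash s x).2⟩

theorem card_values_filter_le (A : Finset U) (s : F.Seed) {l k : ℕ} (h : l ≤ k) :
    ((F.values A s).filter fun y => y ≤ l).card ≤ F.countLt A k s := by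
  rw [values, Finset.filter_image]
  refine Finset.card_image_le.trans (Finset.card_le_card fun x hx => ?_)
  rw [Finset.mem_filter] at hx ⊢
  exact ⟨hx.1, by omega⟩

theorem countLt_range (A : Finset U) (s : F.Seed) : F.countLt A N s = A.card := by
  rw [countLt, Finset.filter_true_of_mem fun x _ => (F.hash s x).2]

open Classical in
-- An overestimate forces at least `t` elements to hash below the cutoff `y`, where at most `3 / 4 *
-- t` are expected. Chebyshev with deviation `t / 4` gives `12 / t ≤ 1 / 16`. Collisions only lower
-- the estimate and do no harm here.
theorem card_estimate_too_large [Nontrivial U] (A : Finset U) (hA : 0 < A.card) {t : ℕ}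
    (ht : 192 ≤ t) :
    ((Finset.univ.filter fun s =>
      4 / 3 * (A.card : ℝ) < sketchEstimate t N (smallest t (F.values A s))).card : ℝ) ≤
      1 / 16 * Fintype.card F.Seed := by
  have hN : (0 : ℝ) < N := by exact_mod_cast F.range_pos
  have hm : (0 : ℝ) < A.card := by exact_mod_cast hA
  have ht' : (192 : ℝ) ≤ t := by exact_mod_cast ht
  set m : ℝ := (A.card : ℝ) with hm_def
  set y : ℕ := min N ⌊3 * (t : ℝ) * N / (4 * m)⌋₊ with hy
  have hμ : m * y / N ≤ 3 / 4 * t := by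
    have h1 : (y : ℝ) ≤ 3 * (t : ℝ) * N / (4 * m) :=
      (Nat.cast_le.2 (min_le_right _ _)).trans (Nat.floor_le (by positivity))
    rw [le_div_iff₀ (by positivity)] at h1
    rw [div_le_iff₀ hN]
    linarith
  have h := F.chebyshev A (min_le_left N ⌊3 * (t : ℝ) * N / (4 * m)⌋₊)
    (fun s => 4 / 3 * m < sketchEstimate t N (smallest t (F.values A s)))
    (b := t / 4) (by positivity) fun s hs => by
      rw [← hm_def, ← hy]
      rcases Nat.lt_or_ge (smallest t (F.values A s)).card t with hlt | hge
      · rw [sketchEstimate_of_card_lt hlt] at hs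
        have : ((F.values A s).card : ℝ) ≤ m :=
          Nat.cast_le.2 (F.card_values_le A s)
        linarith
      · obtain ⟨l, hl, hest, hl1, -⟩ := exists_sketchEstimate_eq N (by omega) hge
        have hlb := F.mem_values_bounds hl
        have hl0 : (0 : ℝ) < l := by exact_mod_cast hlb.1
        have hly : l ≤ y := by
          refine le_min hlb.2 (Nat.le_floor ?_)
          rw [hest, lt_div_iff₀ hl0] at hs
          rw [le_div_iff₀ (by positivity)]
          linarith
        have h1 : (t : ℝ) ≤ F.countLt A y s := by
          exact_mod_cast hl1.trans (F.card_values_filter_le A s hly)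
        exact le_trans (by linarith) (le_abs_self _)
  rw [← hm_def, ← hy] at h
  have hS : (0 : ℝ) ≤ Fintype.card F.Seed := Nat.cast_nonneg _
  have h2 := h.trans (mul_le_mul_of_nonneg_right hμ hS)
  set q : ℝ := (Finset.card _ : ℝ)
  have hq : (0 : ℝ) ≤ q := Nat.cast_nonneg _
  have h3 : (q * t) * t ≤ (12 * Fintype.card F.Seed) * t := by linarith
  have h4 := le_of_mul_le_mul_right h3 (by linarith)
  nlinarith

open Classical in
-- An underestimate means too few distinct small values: either few elements hash below the cutoff,
-- or many of them collide. The range hypothesis keeps the expected number of ordered collisions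
-- below `k` at most an eighth of the expected count.
theorem card_estimate_too_small [Nontrivial U] (A : Finset U) (hA : 0 < A.card)
    (hAN : 8 * (A.card - 1) ≤ N) {t : ℕ} (ht : 1952 ≤ t) :
    ((Finset.univ.filter fun s =>
      sketchEstimate t N (smallest t (F.values A s)) < 2 / 3 * (A.card : ℝ)).card : ℝ) ≤
      5 / 16 * Fintype.card F.Seed := by
  have hN0 : 0 < N := F.range_pos
  have hN : (0 : ℝ) < N := by exact_mod_cast hN0
  have hm : (0 : ℝ) < A.card := by exact_mod_cast hA
  have hmN : (A.card : ℝ) / N ≤ 9 / 8 := by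
    have : (8 * A.card : ℝ) ≤ N + 8 := by
      have : 8 * A.card ≤ N + 8 := by omega
      exact_mod_cast this
    have hN1 : (1 : ℝ) ≤ N := by exact_mod_cast hN0
    rw [div_le_iff₀ hN]
    linarith
  have ht' : (1952 : ℝ) ≤ t := by exact_mod_cast ht
  have hS : (0 : ℝ) ≤ Fintype.card F.Seed := Nat.cast_nonneg _
  have hW := fun k : ℕ => F.markov_collisions A hAN (k := k)
  have hC := fun k : ℕ => F.chebyshev A (k := k)
  have hfull := F.countLt_range A
  have hdist := F.countLt_le A
  set m : ℝ := (A.card : ℝ) with hm_def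
  rcases le_or_gt m (3 / 2 * t) with hmt | hmt
  -- For `m ≤ 3 / 2 * t` a full sketch gives at least `t ≥ 2 / 3 * m`, so only collisions can hurt:
  -- at least `2 / 3 * m` of them, against an expectation of at most `m / 8`.
  · have h := hW N le_rfl
      (fun s => sketchEstimate t N (smallest t (F.values A s)) < 2 / 3 * m)
      (b := 2 / 3 * m) fun s hs => by
        rcases Nat.lt_or_ge (smallest t (F.values A s)).card t with hlt | hge
        · rw [sketchEstimate_of_card_lt hlt] at hs
          have h1 : 2 * A.card ≤ 2 * (F.values A s).card + F.collisionsLt A N s := by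
            have h2 := hdist N s
            rw [hfull] at h2
            have h3 := Finset.card_filter_le (F.values A s) (fun y => y ≤ N)
            exact h2.trans (by unfold values at h3 ⊢; omega)
          have h1' : 2 * m ≤ 2 * ((F.values A s).card : ℝ) + F.collisionsLt A N s := by
            rw [hm_def]
            exact_mod_cast h1
          linarith
        · obtain ⟨l, hl, hest, -, -⟩ := exists_sketchEstimate_eq N (by omega) hge
          have hlb := F.mem_values_bounds hl
          have hl0 : (0 : ℝ) < l := by exact_mod_cast hlb.1
          have hlN : (l : ℝ) ≤ N := by exact_mod_cast hlb.2
          rw [hest, div_lt_iff₀ hl0] at hs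
          nlinarith
    rw [mul_div_assoc, div_self hN.ne', mul_one] at h
    set q : ℝ := (Finset.card _ : ℝ)
    have h3 : q * m ≤ (3 / 16 * Fintype.card F.Seed) * m := by linarith
    have h4 := le_of_mul_le_mul_right h3 hm
    linarith
  · set x : ℕ := ⌊3 * (t : ℝ) * N / (2 * m)⌋₊ with hx
    have hx1 : (x : ℝ) ≤ 3 * (t : ℝ) * N / (2 * m) := Nat.floor_le (by positivity)
    have hx2 : 3 * (t : ℝ) * N / (2 * m) < x + 1 := Nat.lt_floor_add_one _
    have hxl : ∀ l : ℕ, 3 * (t : ℝ) * N / (2 * m) < l → x < l := fun l hl => by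
      exact_mod_cast hx1.trans_lt hl
    rw [le_div_iff₀ (by positivity)] at hx1
    rw [div_lt_iff₀ (by positivity)] at hx2
    have hxN : x ≤ N := by
      have : (x : ℝ) ≤ N := by nlinarith
      exact_mod_cast this
    have hμ1 : m * x / N ≤ 3 / 2 * t := by
      rw [div_le_iff₀ hN]
      linarith
    have hμ2 : 3 / 2 * t - 9 / 8 ≤ m * x / N := by
      have h1 : 3 / 2 * t ≤ m * (x + 1) / N := by
        rw [le_div_iff₀ hN]
        linarith
      have h2 : m * (x + 1) / N = m * x / N + m / N := by ring
      linarith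
    -- The expected count is `3 / 2 * t` up to a rounding loss of `9 / 8`, so a count of at most `11
    -- / 8 * t` deviates by at least `t / 9`. With a larger count, fewer than `t` distinct values
    -- require `2 * (11 / 8 - 1) * t = 3 / 4 * t` collisions. The two events cost `243 / (2 * t) ≤ 1
    -- / 16` and `1 / 4`.
    have h1 := hC x hxN (fun s => (F.countLt A x s : ℝ) ≤ 11 / 8 * t) (b := t / 9)
      (by positivity) fun s hs => by
        rw [abs_sub_comm]
        exact le_trans (by linarith) (le_abs_self _)
    have h2 := hW x hxN (fun s => 3 / 4 * (t : ℝ) ≤ F.collisionsLt A x s) (b := 3 / 4 * t)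
      fun s hs => hs
    have hsub : (Finset.univ.filter fun s =>
          sketchEstimate t N (smallest t (F.values A s)) < 2 / 3 * m) ⊆
        (Finset.univ.filter fun s => (F.countLt A x s : ℝ) ≤ 11 / 8 * t) ∪
          (Finset.univ.filter fun s => 3 / 4 * (t : ℝ) ≤ F.collisionsLt A x s) := by
      intro s hs
      simp only [Finset.mem_union, Finset.mem_filter, Finset.mem_univ, true_and] at hs ⊢
      have hfew : ((F.values A s).filter fun y => y ≤ x).card < t := by
        rcases Nat.lt_or_ge (smallest t (F.values A s)).card t with hlt | hge
        · rw [smallest_eq_self_of_card_lt hlt] at hlt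
          exact (Finset.card_filter_le _ _).trans_lt hlt
        · obtain ⟨l, hl, hest, -, hl2⟩ := exists_sketchEstimate_eq N (by omega) hge
          have hlb := F.mem_values_bounds hl
          have hl0 : (0 : ℝ) < l := by exact_mod_cast hlb.1
          have hlx : x < l := by
            refine hxl l ?_
            rw [hest, div_lt_iff₀ hl0] at hs
            rw [div_lt_iff₀ (by positivity)]
            linarith
          refine lt_of_le_of_lt (Finset.card_le_card fun y hy => ?_) hl2
          rw [Finset.mem_filter] at hy ⊢
          exact ⟨hy.1, hy.2.trans_lt hlx⟩
      have h3 : 2 * (F.countLt A x s : ℝ) ≤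
          2 * (((F.values A s).filter fun y => y ≤ x).card : ℝ) + F.collisionsLt A x s := by
        exact_mod_cast hdist x s
      have hfew' : (((F.values A s).filter fun y => y ≤ x).card : ℝ) < t := by exact_mod_cast hfew
      by_contra hcon
      rw [not_or, not_le, not_le] at hcon
      linarith [hcon.1, hcon.2]
    have h3 := (Finset.card_le_card hsub).trans (Finset.card_union_le _ _)
    have h3' := (Nat.cast_le (α := ℝ)).2 h3
    rw [Nat.cast_add] at h3'
    refine h3'.trans ?_
    have h1' := h1.trans (mul_le_mul_of_nonneg_right hμ1 hS)
    have h2' := h2.trans (mul_le_mul_of_nonneg_right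
      (div_le_div_of_nonneg_right hμ1 (by norm_num)) hS)
    set q₁ : ℝ :=
      ((Finset.univ.filter fun s => (F.countLt A x s : ℝ) ≤ 11 / 8 * t).card : ℝ)
    set q₂ : ℝ :=
      ((Finset.univ.filter fun s => 3 / 4 * (t : ℝ) ≤ F.collisionsLt A x s).card : ℝ)
    have hq₁ : (0 : ℝ) ≤ q₁ := Nat.cast_nonneg _
    have h4 : (q₁ * t) * t ≤ (243 / 2 * Fintype.card F.Seed) * t := by linarith
    have h5 := le_of_mul_le_mul_right h4 (by linarith)
    have h6 : q₂ * t ≤ (1 / 4 * Fintype.card F.Seed) * t := by linarith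
    have h7 := le_of_mul_le_mul_right h6 (by linarith)
    have h8 : q₁ * 1952 ≤ q₁ * t := mul_le_mul_of_nonneg_left ht' hq₁
    linarith

open Classical in
/-- The estimate of one hash function has a relative error of more than `1/3` with probability at
most `3/8`. -/
theorem card_estimate_inaccurate [Nontrivial U] (A : Finset U)
    (hAN : 8 * (A.card - 1) ≤ N) {t : ℕ} (ht : 1952 ≤ t) :
    ((Finset.univ.filter fun s => sketchEstimate t N (smallest t (F.values A s)) ∉
      Set.Icc (2 / 3 * (A.card : ℝ)) (4 / 3 * (A.card : ℝ))).card : ℝ) ≤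
      3 / 8 * Fintype.card F.Seed := by
  rcases Nat.eq_zero_or_pos A.card with hA | hA
  · rw [Finset.filter_false_of_mem]
    · rw [Finset.card_empty, Nat.cast_zero]
      positivity
    · intro s _
      rw [Finset.card_eq_zero.1 hA]
      have h : smallest t (F.values ∅ s) = ∅ := by simp [values, smallest]
      have h0 : 0 < t := by omega
      simp [h, sketchEstimate, h0]
  · have h1 := F.card_estimate_too_large A hA (t := t) (by omega)
    have h2 := F.card_estimate_too_small A hA hAN ht
    have hsub : (Finset.univ.filter fun s => sketchEstimate t N (smallest t (F.values A s)) ∉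
        Set.Icc (2 / 3 * (A.card : ℝ)) (4 / 3 * (A.card : ℝ))) ⊆
        (Finset.univ.filter fun s =>
          4 / 3 * (A.card : ℝ) < sketchEstimate t N (smallest t (F.values A s))) ∪
        (Finset.univ.filter fun s =>
          sketchEstimate t N (smallest t (F.values A s)) < 2 / 3 * (A.card : ℝ)) := by
      intro s hs
      simp only [Finset.mem_union, Finset.mem_filter, Finset.mem_univ, true_and, Set.mem_Icc,
        not_and_or, not_le] at hs ⊢
      exact hs.symm
    have h3' := (Nat.cast_le (α := ℝ)).2
      ((Finset.card_le_card hsub).trans (Finset.card_union_le _ _))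
    rw [Nat.cast_add] at h3'
    linarith

/-- The probability that at least half of `r` independent hash functions are bad, if each is bad
with probability at most `3/8`. -/
theorem _root_.card_half_bad_le {S : Type*} [Fintype S] (bad : S → Prop) [DecidablePred bad]
    (h : ((Finset.univ.filter bad).card : ℝ) ≤ 3 / 8 * Fintype.card S) (r : ℕ) :
    ((Finset.univ.filter fun σ : Fin r → S =>
      r ≤ 2 * (Finset.univ.filter fun i => bad (σ i)).card).card : ℝ) ≤
      (31 / 32) ^ r * Fintype.card (Fin r → S) := by
  -- Exponential moment: with half of the functions bad the product is at least `(4 / 3) ^ r`, while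
  -- the mean of `f` is at most `1 + 7 / 9 * 3 / 8 = 31 / 24`; the quotient is `31 / 32`.
  let f : S → ℝ := fun s => if bad s then 16 / 9 else 1
  have hprod : ∀ σ : Fin r → S,
      ∏ i, f (σ i) = (16 / 9 : ℝ) ^ (Finset.univ.filter fun i => bad (σ i)).card := by
    intro σ
    rw [← Finset.prod_const, Finset.prod_filter]
  have h1 := card_mul_le_sum (fun σ : Fin r → S =>
    r ≤ 2 * (Finset.univ.filter fun i => bad (σ i)).card) (fun σ => ∏ i, f (σ i))
    (b := (4 / 3) ^ r) (fun σ => by rw [hprod]; positivity) fun σ hσ => by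
      have h43 : (16 / 9 : ℝ) = (4 / 3) ^ 2 := by norm_num
      rw [hprod, h43, ← pow_mul]
      exact pow_le_pow_right₀ (by norm_num : (1 : ℝ) ≤ 4 / 3) hσ
  rw [← Fintype.sum_pow] at h1
  have h2 : ∑ s, f s ≤ 31 / 24 * Fintype.card S := by
    have : ∀ s, f s = 1 + 7 / 9 * (if bad s then 1 else 0) := by
      intro s
      simp only [f]
      split_ifs <;> norm_num
    simp only [this, Finset.sum_add_distrib, ← Finset.mul_sum, Finset.sum_boole,
      Finset.sum_const, nsmul_eq_mul, Finset.card_univ, mul_one]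
    linarith
  have h3 : 0 ≤ ∑ s, f s := Finset.sum_nonneg fun s _ => by
    simp only [f]
    split_ifs <;> norm_num
  have h4 := h1.trans (pow_le_pow_left₀ h3 h2 r)
  rw [← le_div_iff₀ (by positivity)] at h4
  refine h4.trans_eq ?_
  rw [Fintype.card_fun, Fintype.card_fin, Nat.cast_pow, ← mul_pow, ← div_pow]
  congr 1
  ring

open Classical in
/-- The median estimate has a relative error of more than `1/3` with exponentially small
probability. -/
theorem card_median_inaccurate [Nontrivial U] (A : Finset U)
    (hAN : 8 * (A.card - 1) ≤ N) {t : ℕ} (ht : 1952 ≤ t) (r : ℕ) :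
    ((Finset.univ.filter fun σ : Fin r → F.Seed =>
      median (fun i => sketchEstimate t N (smallest t (F.values A (σ i)))) ∉
      Set.Icc (2 / 3 * (A.card : ℝ)) (4 / 3 * (A.card : ℝ))).card : ℝ) ≤
      (31 / 32) ^ r * Fintype.card (Fin r → F.Seed) := by
  refine le_trans (Nat.cast_le.2 (Finset.card_le_card fun σ hσ => ?_))
    (card_half_bad_le _ (F.card_estimate_inaccurate A hAN ht) r)
  simp only [Finset.mem_filter, Finset.mem_univ, true_and] at hσ ⊢
  by_contra hlt
  exact hσ (median_mem_Icc (not_le.1 hlt))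

end HashFamily

/-! ### Failure probabilities -/

namespace PMF

open scoped ENNReal

variable {α β : Type*}

/-- Failure probabilities are bounded through `toOuterMeasure`, so no measurability question arises.
-/
theorem toOuterMeasure_le_one (p : PMF α) (s : Set α) : p.toOuterMeasure s ≤ 1 := by
  rw [← (p.toOuterMeasure_apply_eq_one_iff Set.univ).2 (Set.subset_univ _)]
  exact MeasureTheory.measure_mono (Set.subset_univ s)

/-- Only the excess `x` of the bad outcomes is weighted by their probability; in the sampling
induction this produces the factor `θ` per stale sample. -/
theorem toOuterMeasure_bind_le_mul_add (p : PMF α) (f : α → PMF β) (s : Set β) (bad : Set α)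
    (x y : ℝ≥0∞) (h1 : ∀ a ∈ bad, (f a).toOuterMeasure s ≤ x + y)
    (h2 : ∀ a ∈ p.support, a ∉ bad → (f a).toOuterMeasure s ≤ y) :
    (p.bind f).toOuterMeasure s ≤ p.toOuterMeasure bad * x + y := by
  rw [toOuterMeasure_bind_apply, toOuterMeasure_apply, ← ENNReal.tsum_mul_right]
  calc ∑' a, p a * (f a).toOuterMeasure s
      ≤ ∑' a, (bad.indicator p a * x + p a * y) := by
        refine ENNReal.tsum_le_tsum fun a => ?_
        by_cases ha : a ∈ bad
        · rw [Set.indicator_of_mem ha, ← mul_add]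
          gcongr
          exact h1 a ha
        · rw [Set.indicator_of_notMem ha, zero_mul, zero_add]
          by_cases hp : a ∈ p.support
          · gcongr
            exact h2 a hp ha
          · rw [(p.apply_eq_zero_iff a).2 hp, zero_mul, zero_mul]
    _ = ∑' a, bad.indicator p a * x + y := by
        rw [ENNReal.tsum_add, ENNReal.tsum_mul_right (a := y), p.tsum_coe, one_mul]

theorem toOuterMeasure_bind_le_add {p : PMF α} {f : α → PMF β} {s : Set β} {bad : Set α}
    {x y : ℝ≥0∞} (h1 : p.toOuterMeasure bad ≤ x)
    (h2 : ∀ a ∈ p.support, a ∉ bad → (f a).toOuterMeasure s ≤ y) :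
    (p.bind f).toOuterMeasure s ≤ x + y := by
  refine (toOuterMeasure_bind_le_mul_add p f s bad 1 y (fun a _ => ?_) h2).trans ?_
  · exact (toOuterMeasure_le_one _ _).trans le_self_add
  · rw [mul_one]
    gcongr

theorem toOuterMeasure_uniform_le {α : Type*} [Fintype α] [Nonempty α] (p : α → Prop)
    [DecidablePred p] {c : ℝ}
    (h : ((Finset.univ.filter p).card : ℝ) ≤ c * Fintype.card α) :
    (uniformOfFintype α).toOuterMeasure {a | p a} ≤ ENNReal.ofReal c := by
  rw [toOuterMeasure_uniformOfFintype_apply]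
  have hpos : (0 : ℝ) < Fintype.card α := by exact_mod_cast Fintype.card_pos
  rw [ENNReal.div_le_iff (by simp) (by simp)]
  have h1 : Fintype.card ({a | p a} : Set α) = (Finset.univ.filter p).card :=
    Fintype.card_subtype p
  have hc : 0 ≤ c := by
    have h0 : (0 : ℝ) ≤ (Finset.univ.filter p).card := Nat.cast_nonneg _
    exact nonneg_of_mul_nonneg_left (h0.trans h) hpos
  rw [h1, ← ENNReal.ofReal_natCast, ← ENNReal.ofReal_natCast (Fintype.card α),
    ← ENNReal.ofReal_mul hc]
  exact ENNReal.ofReal_le_ofReal h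

theorem one_sub_le_toOuterMeasure (p : PMF α) (s : Set α) {ε : ℝ} (hε : 0 ≤ ε)
    (h : p.toOuterMeasure sᶜ ≤ ENNReal.ofReal ε) :
    ENNReal.ofReal (1 - ε) ≤ p.toOuterMeasure s := by
  rw [ENNReal.ofReal_sub _ hε, ENNReal.ofReal_one, tsub_le_iff_right,
    ← (p.toOuterMeasure_apply_eq_one_iff Set.univ).2 (Set.subset_univ _), ← Set.union_compl_self s]
  refine (MeasureTheory.measure_union_le _ _).trans ?_
  gcongr

end PMF

/-! ### The estimation procedure -/

namespace EstimatorParams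

open scoped ENNReal

variable {V : Type*}

/-- All estimates are correct up to a relative error of `1/3`. -/
def IsAccurate [DecidableEq V] (H : Dag V) (e : (V → ℝ) × (V → ℝ)) : Prop :=
  ∀ v, e.1 v ∈ Set.Icc (2 / 3 * ((H.anc v).card : ℝ)) (4 / 3 * ((H.anc v).card : ℝ)) ∧
    e.2 v ∈ Set.Icc (2 / 3 * ((H.ancEdges {v}).card : ℝ)) (4 / 3 * ((H.ancEdges {v}).card : ℝ))

theorem vertexEstimate_eq [Finite V] [DecidableEq V] (P : EstimatorParams V) (H : Dag V)
    (σ : Fin P.r → P.vertexHash.Seed) (v : V) :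
    P.vertexEstimate H σ v = median fun i => sketchEstimate P.t P.range
      (smallest P.t (P.vertexHash.values (H.anc v) (σ i))) := by
  simp only [vertexEstimate, sketch_eq_smallest, HashFamily.values, Finset.biUnion_singleton]

theorem edgeEstimate_eq [Finite V] [DecidableEq V] (P : EstimatorParams V) (H : Dag V)
    (τ : Fin P.r → P.edgeHash.Seed) (v : V) :
    P.edgeEstimate H τ v = median fun i => sketchEstimate P.t P.range
      (smallest P.t (P.edgeHash.values (H.ancEdges {v}) (τ i))) := by
  simp only [edgeEstimate, sketch_eq_smallest, HashFamily.values, Dag.ancEdges_singleton,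
    Finset.biUnion_image, Finset.image_image]
  rfl

/-- Equality is possible for two vertices, which is why the collision bound is stated with `A.card -
1`. -/
theorem eight_mul_card_anc_le [Fintype V] (hV : 2 ≤ Fintype.card V) (H : Dag V) (v : V) :
    8 * ((H.anc v).card - 1) ≤ Fintype.card V ^ 3 := by
  have h := Finset.card_le_univ (H.anc v)
  obtain ⟨j, hj⟩ := Nat.exists_eq_add_of_le hV
  rw [hj] at h ⊢
  have : (H.anc v).card - 1 ≤ j + 1 := by omega
  nlinarith [sq_nonneg (j : ℤ), Nat.zero_le (j ^ 3), Nat.zero_le (j ^ 2)]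

theorem eight_mul_card_ancEdges_le [Fintype V] [DecidableEq V] (hV : 2 ≤ Fintype.card V) (H : Dag V) (v : V) :
    8 * ((H.ancEdges {v}).card - 1) ≤ Fintype.card V ^ 3 := by
  have h1 : (H.ancEdges {v}).card ≤ H.edges.card :=
    Finset.card_le_card (Finset.filter_subset _ _)
  have h := H.two_mul_card_edges_le
  obtain ⟨j, hj⟩ := Nat.exists_eq_add_of_le hV
  rw [hj] at h ⊢
  have h2 : 2 + j - 1 = j + 1 := by omega
  rw [h2] at h
  have : (H.ancEdges {v}).card - 1 ≤ (H.ancEdges {v}).card := Nat.sub_le _ _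
  nlinarith [Nat.zero_le (j ^ 3), Nat.zero_le (j ^ 2)]

theorem estimate_inaccurate_le [Fintype V] [DecidableEq V] (P : EstimatorParams V) (hV : 2 ≤ Fintype.card V)
    (hrange : P.range = Fintype.card V ^ 3) (ht : 1952 ≤ P.t) (H : Dag V) :
    (P.estimate H).toOuterMeasure {e | ¬ IsAccurate H e} ≤
      2 * Fintype.card V * ENNReal.ofReal ((31 / 32) ^ P.r) := by
  classical
  have : Nontrivial V := Fintype.one_lt_card_iff_nontrivial.1 hV
  set δ := ENNReal.ofReal ((31 / 32) ^ P.r)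
  have hunion : ∀ {α : Type} [Fintype α] [Nonempty α] (p : V → α → Prop),
      (∀ v, (PMF.uniformOfFintype α).toOuterMeasure {a | p v a} ≤ δ) →
      (PMF.uniformOfFintype α).toOuterMeasure {a | ∃ v, p v a} ≤ Fintype.card V * δ := by
    intro α _ _ p h
    rw [Set.ofPred_exists]
    refine (MeasureTheory.measure_iUnion_fintype_le _ _).trans ?_
    refine (Finset.sum_le_sum fun v _ => h v).trans_eq ?_
    rw [Finset.sum_const, nsmul_eq_mul, Finset.card_univ]
  rw [two_mul, add_mul]
  refine PMF.toOuterMeasure_bind_le_add (hunion (fun v σ => P.vertexEstimate H σ v ∉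
    Set.Icc (2 / 3 * ((H.anc v).card : ℝ)) (4 / 3 * ((H.anc v).card : ℝ))) fun v => ?_)
    fun σ _ hσ => ?_
  · simp only [vertexEstimate_eq]
    exact PMF.toOuterMeasure_uniform_le _ (P.vertexHash.card_median_inaccurate _
      (hrange ▸ eight_mul_card_anc_le hV H v) ht P.r)
  rw [← add_zero (_ * δ)]
  refine PMF.toOuterMeasure_bind_le_add (hunion (fun v τ => P.edgeEstimate H τ v ∉
    Set.Icc (2 / 3 * ((H.ancEdges {v}).card : ℝ)) (4 / 3 * ((H.ancEdges {v}).card : ℝ)))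
    fun v => ?_) fun τ _ hτ => ?_
  · simp only [edgeEstimate_eq]
    exact PMF.toOuterMeasure_uniform_le _ (P.edgeHash.card_median_inaccurate _
      (hrange ▸ eight_mul_card_ancEdges_le hV H v) ht P.r)
  rw [PMF.toOuterMeasure_pure_apply, if_neg]
  simp only [Set.mem_ofPred_eq, not_exists, not_not] at hσ hτ ⊢
  exact fun v => ⟨hσ v, hτ v⟩

end EstimatorParams

/-! ### Pruning -/

section Freshness

variable {V : Type*} [DecidableEq V]

theorem Dag.ancSet_mono (H : Dag V) {B B' : Finset V} (h : B ⊆ B') : H.ancSet B ⊆ H.ancSet B' :=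
  Finset.biUnion_subset_biUnion_of_subset_left _ h

theorem Dag.ancEdges_mono (H : Dag V) {B B' : Finset V} (h : B ⊆ B') :
    H.ancEdges B ⊆ H.ancEdges B' := fun e he => by
  have he := Finset.mem_filter.1 he
  exact Finset.mem_filter.2 ⟨he.1, H.ancSet_mono h he.2.1, H.ancSet_mono h he.2.2⟩

theorem IsFresh.mono {H : Dag V} {γ : ℝ} {B B' : Finset V} {v : V} (h : B ⊆ B')
    (hv : IsFresh H γ B' v) : IsFresh H γ B v :=
  ⟨hv.1.trans_le (Nat.cast_le.2 (Finset.card_le_card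
      (Finset.sdiff_subset_sdiff le_rfl (H.ancSet_mono h)))),
    hv.2.trans_le (Nat.cast_le.2 (Finset.card_le_card
      (Finset.sdiff_subset_sdiff le_rfl (H.ancEdges_mono h))))⟩

open Classical in
/-- The vertices of the bucket `K` that are fresh with respect to `B`. -/
noncomputable def freshIn (H : Dag V) (γ : ℝ) (K B : Finset V) : Finset V :=
  K.filter (IsFresh H γ B)

theorem mem_freshIn {H : Dag V} {γ : ℝ} {K B : Finset V} {v : V} :
    v ∈ freshIn H γ K B ↔ v ∈ K ∧ IsFresh H γ B v := by
  simp only [freshIn, Finset.mem_filter]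

theorem freshIn_mono (H : Dag V) (γ : ℝ) {K K' B B' : Finset V} (hK : K' ⊆ K) (hB : B ⊆ B') :
    freshIn H γ K' B' ⊆ freshIn H γ K B := fun v hv => by
  have hv := mem_freshIn.1 hv
  exact mem_freshIn.2 ⟨hK hv.1, hv.2.mono hB⟩

theorem prune_support [Finite V] {P : EstimatorParams V} {H : Dag V} {γ : ℝ}
    {S R : BatchState V} (hR : R ∈ (prune P H γ S).support) (i : ℕ) : R.K i ⊆ S.K i := by
  simp only [prune, PMF.mem_support_bind_iff, PMF.mem_support_pure_iff] at hR
  obtain ⟨e, -, e', -, rfl⟩ := hR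
  exact Finset.filter_subset _ _

/-- The threshold `2 * γ` matches the relative error `1/3`, because `(4 / 3) / (2 / 3) = 2`. -/
theorem le_two_mul_of_stale {γ x y e e' : ℝ} (hγ : 0 ≤ γ) (h : y ≤ γ * x) (he : 2 / 3 * x ≤ e)
    (he' : e' ≤ 4 / 3 * y) : e' ≤ 2 * γ * e := by
  nlinarith [mul_le_mul_of_nonneg_left he hγ]

/-- Pruning removes all stale vertices, unless an estimate is inaccurate. -/
theorem prune_stale_le [Fintype V] (P : EstimatorParams V) (hV : 2 ≤ Fintype.card V)
    (hrange : P.range = Fintype.card V ^ 3) (ht : 1952 ≤ P.t) (H : Dag V) {γ : ℝ} (hγ : 0 ≤ γ)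
    (S : BatchState V) :
    (prune P H γ S).toOuterMeasure {R | ¬ ∀ i, R.K i ⊆ freshIn H γ (S.K i) S.B} ≤
      4 * Fintype.card V * ENNReal.ofReal ((31 / 32) ^ P.r) := by
  have h4 : (4 : ENNReal) = 2 + 2 := by norm_num
  rw [h4, add_mul, add_mul]
  refine PMF.toOuterMeasure_bind_le_add (P.estimate_inaccurate_le hV hrange ht H)
    fun e _ he => ?_
  rw [← add_zero (2 * _ * _)]
  refine PMF.toOuterMeasure_bind_le_add (P.estimate_inaccurate_le hV hrange ht _)
    fun e' _ he' => ?_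
  rw [PMF.toOuterMeasure_pure_apply, if_neg]
  simp only [Set.mem_ofPred_eq, not_not] at he he' ⊢
  intro i v hv
  obtain ⟨hvK, hv⟩ := Finset.mem_filter.1 hv
  rw [not_or] at hv
  refine mem_freshIn.2 ⟨hvK, ?_⟩
  by_contra hstale
  rw [IsFresh, not_and_or, not_lt, not_lt] at hstale
  -- Only an upper bound for the estimates in the pruned graph is needed, so inclusion of its
  -- ancestor and edge sets in the uncovered ones suffices.
  rcases hstale with h | h
  · refine hv.1 (le_two_mul_of_stale hγ h (he v).1.1 ((he' v).1.2.trans ?_))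
    gcongr
    exact H.anc_remove_subset _ _
  · refine hv.2 (le_two_mul_of_stale hγ h (he v).2.1 ((he' v).2.2.trans ?_))
    gcongr
    exact H.ancEdges_remove_subset _ _

end Freshness

/-! ### Sampling -/

section Sampling

open scoped ENNReal

variable {V : Type*} [DecidableEq V]

theorem sampleBucket_support {H : Dag V} {γ : ℝ} {N : ℕ} (K B : Finset V) (s : ℕ)
    {R : Finset V × Finset V} (hR : R ∈ (sampleBucket H γ N K B s).support) :
    R.1 ⊆ K ∧ B ⊆ R.2 ∧ (s < N → K.Nonempty → R.1.card < K.card) := by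
  induction K using Finset.strongInduction generalizing B s with
  | H K ih =>
    rw [sampleBucket] at hR
    split_ifs at hR with h
    · rw [PMF.mem_support_bind_iff] at hR
      obtain ⟨v, -, hR⟩ := hR
      have hss := Finset.erase_ssubset v.2
      suffices R.1 ⊆ K.erase v.1 ∧ B ⊆ R.2 from
        ⟨this.1.trans (Finset.erase_subset _ _), this.2, fun _ _ =>
          (Finset.card_le_card this.1).trans_lt (Finset.card_lt_card hss)⟩
      split_ifs at hR
      · have := ih _ hss _ _ hR
        exact ⟨this.1, (Finset.subset_insert _ _).trans this.2.1⟩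
      · have := ih _ hss _ _ hR
        exact ⟨this.1, this.2.1⟩
    · rw [PMF.mem_support_pure_iff] at hR
      subst hR
      exact ⟨le_rfl, le_rfl, fun h1 h2 => absurd ⟨h1, h2⟩ h⟩

/-- With high probability, at most a fraction `1 - θ` of a bucket is still in the bucket and fresh
when the sampling stops. -/
theorem sampleBucket_le (H : Dag V) (γ : ℝ) (N : ℕ) {θ : ℝ} (hθ : θ ≤ 1) (M : ℕ)
    (K B : Finset V) (s : ℕ) (hK : K.card ≤ M) (hs : s ≤ N) :
    (sampleBucket H γ N K B s).toOuterMeasure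
        {R | (1 - θ) * M < ((freshIn H γ R.1 R.2).card : ℝ)} ≤
      ENNReal.ofReal θ ^ (N - s) + K.card * ENNReal.ofReal θ ^ N := by
  classical
  induction K using Finset.strongInduction generalizing B s with
  | H K ih =>
    -- Once the fresh vertices are few they stay few, since the bucket shrinks and the batch grows;
    -- the bad event is then impossible.
    by_cases hF : ((freshIn H γ K B).card : ℝ) ≤ (1 - θ) * M
    · refine le_of_eq_of_le ((PMF.toOuterMeasure_apply_eq_zero_iff _ _).2 ?_) zero_le
      rw [Set.disjoint_left]
      intro R hR hbad
      have h := sampleBucket_support K B s hR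
      have h1 := (Nat.cast_le (α := ℝ)).2 (Finset.card_le_card (freshIn_mono H γ h.1 h.2.1))
      exact absurd hbad (not_lt.2 (h1.trans hF))
    rw [not_le] at hF
    have hKne : K.Nonempty := by
      rw [Finset.nonempty_iff_ne_empty]
      rintro rfl
      have : (0 : ℝ) ≤ (1 - θ) * M := mul_nonneg (by linarith) (Nat.cast_nonneg _)
      simp only [freshIn, Finset.filter_empty, Finset.card_empty, Nat.cast_zero] at hF
      linarith
    rw [sampleBucket]
    split_ifs with h
    · have hcard : ∀ v ∈ K, ((K.erase v).card : ℝ≥0∞) + 1 = K.card := fun v hv => by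
        exact_mod_cast Finset.card_erase_add_one hv
      have hKn := hKne.to_subtype
      -- The term `θ ^ (N - s)` pays for completing the current run of stale samples. A fresh sample
      -- opens a new run, whose `θ ^ N` is paid by the removed vertex.
      refine (PMF.toOuterMeasure_bind_le_mul_add _ _ _ {v | ¬ IsFresh H γ B v.1}
        (ENNReal.ofReal θ ^ (N - (s + 1))) (K.card * ENNReal.ofReal θ ^ N)
        (fun v hv => ?_) (fun v _ hv => ?_)).trans ?_
      · rw [if_neg hv]
        refine (ih _ (Finset.erase_ssubset v.2) B (s + 1)
          ((Finset.card_le_card (Finset.erase_subset _ _)).trans hK) h.1).trans ?_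
        gcongr
        exact Finset.erase_subset _ _
      · rw [Set.mem_ofPred_eq, not_not] at hv
        rw [if_pos hv]
        refine (ih _ (Finset.erase_ssubset v.2) _ 0
          ((Finset.card_le_card (Finset.erase_subset _ _)).trans hK) (Nat.zero_le _)).trans ?_
        rw [← hcard v.1 v.2, add_mul, one_mul, Nat.sub_zero, add_comm]
      · have hst : (PMF.uniformOfFintype K).toOuterMeasure {v | ¬ IsFresh H γ B v.1} ≤
            ENNReal.ofReal θ := by
          refine PMF.toOuterMeasure_uniform_le _ ?_
          have h1 : (Finset.univ.filter fun v : K => ¬ IsFresh H γ B v.1).card +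
              (freshIn H γ K B).card = K.card := by
            have h2 : (Finset.univ.filter fun v : K => ¬ IsFresh H γ B v.1).card =
                (K.filter fun v => ¬ IsFresh H γ B v).card := by
              rw [← Finset.card_map (Function.Embedding.subtype _)]
              congr 1
              ext v
              simp only [Finset.mem_map, Finset.mem_filter, Finset.mem_univ, true_and,
                Function.Embedding.subtype_apply, Subtype.exists, exists_and_right,
                exists_eq_right]
              exact ⟨fun ⟨h, h'⟩ => ⟨h, h'⟩, fun ⟨h, h'⟩ => ⟨h, h'⟩⟩
            rw [h2, add_comm, freshIn, Finset.card_filter_add_card_filter_not]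
          have h1' : ((Finset.univ.filter fun v : K => ¬ IsFresh H γ B v.1).card : ℝ) +
              (freshIn H γ K B).card = K.card := by exact_mod_cast h1
          rw [Fintype.card_coe]
          have hKM : (K.card : ℝ) ≤ M := by exact_mod_cast hK
          -- The stale vertices number less than `K.card - (1 - θ) * M ≤ θ * K.card`.
          nlinarith [mul_le_mul_of_nonneg_left hKM (sub_nonneg.2 hθ)]
        gcongr
        calc _ ≤ ENNReal.ofReal θ * ENNReal.ofReal θ ^ (N - (s + 1)) := by gcongr
          _ = ENNReal.ofReal θ ^ (N - s) := by
            rw [← pow_succ']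
            congr 1
            omega
    · have hsN : s = N := by
        by_contra hne
        exact h ⟨lt_of_le_of_ne hs hne, hKne⟩
      rw [hsN, Nat.sub_self, pow_zero]
      exact (PMF.toOuterMeasure_le_one _ _).trans le_self_add

/-- A bound proportional to the bucket size adds up over the buckets to the total size, without a
factor for their number. -/
theorem sampleBucket_start_le (H : Dag V) (γ : ℝ) (N : ℕ) {θ : ℝ} (hθ : θ ≤ 1)
    (K B : Finset V) :
    (sampleBucket H γ N K B 0).toOuterMeasure
        {R | (1 - θ) * K.card < ((freshIn H γ R.1 R.2).card : ℝ)} ≤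
      K.card * (2 * ENNReal.ofReal θ ^ N) := by
  rcases K.eq_empty_or_nonempty with rfl | hK
  · rw [sampleBucket, dif_neg (by simp), PMF.toOuterMeasure_pure_apply, if_neg]
    · exact zero_le
    · simp [freshIn]
  · refine (sampleBucket_le H γ N hθ K.card K B 0 le_rfl (Nat.zero_le _)).trans ?_
    rw [Nat.sub_zero, two_mul, mul_add]
    gcongr
    refine le_mul_of_one_le_left zero_le ?_
    exact_mod_cast hK.card_pos

theorem sampleBuckets_support {H : Dag V} {γ : ℝ} {N : ℕ} (k : ℕ) (S : BatchState V)
    {R : BatchState V} (hR : R ∈ (sampleBuckets H γ N k S).support) :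
    S.B ⊆ R.B ∧ (∀ i, R.K i ⊆ S.K i) ∧
      (0 < N → ∀ i ∈ Finset.Icc 1 k, (S.K i).Nonempty → (R.K i).card < (S.K i).card) := by
  induction k generalizing S with
  | zero =>
    rw [sampleBuckets, PMF.mem_support_pure_iff] at hR
    subst hR
    exact ⟨le_rfl, fun i => le_rfl, fun _ i hi => by simp at hi⟩
  | succ k ih =>
    rw [sampleBuckets, PMF.mem_support_bind_iff] at hR
    obtain ⟨Q, hQ, hR⟩ := hR
    have h1 := sampleBucket_support _ _ _ hQ
    obtain ⟨h2, h3, h4⟩ := ih _ hR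
    refine ⟨h1.2.1.trans h2, fun i => (h3 i).trans ?_, fun hN i hi hne => ?_⟩
    · rcases eq_or_ne i (k + 1) with rfl | hik
      · simpa using h1.1
      · simp [hik]
    · rcases eq_or_ne i (k + 1) with rfl | hik
      · refine (Finset.card_le_card (h3 _)).trans_lt ?_
        simpa using h1.2.2 hN hne
      · rw [Finset.mem_Icc] at hi
        have h5 := h4 hN i (Finset.mem_Icc.2 ⟨hi.1, by omega⟩)
        simp only [Function.update_of_ne hik] at h5
        exact h5 hne

theorem sampleBuckets_le (H : Dag V) (γ : ℝ) (N : ℕ) {θ : ℝ} (hθ : θ ≤ 1) (k : ℕ)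
    (S : BatchState V) :
    (sampleBuckets H γ N k S).toOuterMeasure {R | ∃ i ∈ Finset.Icc 1 k,
        (1 - θ) * (S.K i).card < ((freshIn H γ (R.K i) R.B).card : ℝ)} ≤
      (∑ i ∈ Finset.Icc 1 k, (S.K i).card : ℕ) * (2 * ENNReal.ofReal θ ^ N) := by
  induction k generalizing S with
  | zero => simp [sampleBuckets]
  | succ k ih =>
    rw [sampleBuckets, Finset.sum_Icc_succ_top (by omega),
      add_comm (∑ i ∈ Finset.Icc 1 k, (S.K i).card), Nat.cast_add, add_mul]
    refine PMF.toOuterMeasure_bind_le_add (sampleBucket_start_le H γ N hθ _ _) fun Q _ hQ => ?_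
    rw [Set.mem_ofPred_eq, not_lt] at hQ
    set S' : BatchState V := ⟨Function.update S.K (k + 1) Q.1, Q.2⟩ with hS'
    have hK : ∀ i ∈ Finset.Icc 1 k, S'.K i = S.K i := fun i hi => by
      have : i ≠ k + 1 := by
        have := (Finset.mem_Icc.1 hi).2
        omega
      simp [hS', this]
    have h := ih S'
    rw [Finset.sum_congr rfl fun i hi => by rw [hK i hi]] at h
    refine le_trans (PMF.toOuterMeasure_mono _ ?_) h
    rintro R ⟨⟨i, hi, hbad⟩, hR⟩
    obtain ⟨h2, h3, -⟩ := sampleBuckets_support k S' hR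
    have hi' := Finset.mem_Icc.1 hi
    rcases Nat.lt_or_ge k i with hik | hik
    · obtain rfl : i = k + 1 := by omega
      have h4 : R.K (k + 1) ⊆ Q.1 := by simpa [hS'] using h3 (k + 1)
      have h5 := (Nat.cast_le (α := ℝ)).2 (Finset.card_le_card (freshIn_mono H γ h4 h2))
      -- The bucket sampled first is not refilled and the batch only grows later, so its bound on
      -- fresh survivors is inherited.
      exact absurd hbad (not_lt.2 (h5.trans hQ))
    · have hi2 := Finset.mem_Icc.2 ⟨hi'.1, hik⟩
      exact ⟨i, hi2, by rwa [hK i hi2]⟩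

/-! ### The outer loop -/

/-- The total size of the buckets `K 1, …, K k`. -/
def BatchState.size (k : ℕ) (S : BatchState V) : ℕ := ∑ i ∈ Finset.Icc 1 k, (S.K i).card

/-- The failure probability of an iteration is charged to a vertex removed in it, so the bound
involves the total size and not `T`. The geometric decay enters only through `hT`, which forces the
size to be zero when `T` runs out. -/
theorem whileLoop_le [Fintype V] (P : EstimatorParams V) (hV : 2 ≤ Fintype.card V)
    (hrange : P.range = Fintype.card V ^ 3) (ht : 1952 ≤ P.t) (H : Dag V) {γ : ℝ} (hγ : 0 ≤ γ)
    {N : ℕ} (hN : 0 < N) {θ : ℝ} (hθ : θ ≤ 1) (k m : ℕ) (T : ℕ)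
    (S : BatchState V) (hSm : S.size k ≤ m) (hT : (1 - θ) ^ T * S.size k < 1) :
    (whileLoop P H γ N k T S).toOuterMeasure {R | ¬ AllEmpty k R} ≤
      S.size k * (m * (2 * ENNReal.ofReal θ ^ N) +
        4 * Fintype.card V * ENNReal.ofReal ((31 / 32) ^ P.r)) := by
  set q : ℝ≥0∞ := m * (2 * ENNReal.ofReal θ ^ N) +
        4 * Fintype.card V * ENNReal.ofReal ((31 / 32) ^ P.r) with hq
  induction T generalizing S with
  | zero =>
    rw [pow_zero, one_mul] at hT
    have h0 : S.size k = 0 := by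
      have : S.size k < 1 := by exact_mod_cast hT
      omega
    have hE : AllEmpty k S := fun i hi =>
      Finset.card_eq_zero.1 (Finset.sum_eq_zero_iff.1 h0 i hi)
    rw [whileLoop, PMF.toOuterMeasure_pure_apply, if_neg (by simpa using hE)]
    exact zero_le
  | succ T ih =>
    rw [whileLoop]
    split_ifs with hE
    · rw [PMF.toOuterMeasure_pure_apply, if_neg (by simpa using hE)]
      exact zero_le
    have hdec : ∀ R ∈ (sampleBuckets H γ N k S).support, R.size k < S.size k := by
      intro R hR
      obtain ⟨-, h3, h4⟩ := sampleBuckets_support k S hR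
      simp only [AllEmpty, not_forall] at hE
      obtain ⟨i, hi, hne⟩ := hE
      exact Finset.sum_lt_sum (fun j _ => Finset.card_le_card (h3 j))
        ⟨i, hi, h4 hN i hi (Finset.nonempty_iff_ne_empty.2 hne)⟩
    have hpos : 0 < S.size k := by
      obtain ⟨R, hR⟩ := (sampleBuckets H γ N k S).support_nonempty
      exact (Nat.zero_le _).trans_lt (hdec R hR)
    have hsplit : (S.size k : ℝ≥0∞) * q = m * (2 * ENNReal.ofReal θ ^ N) +
        (4 * Fintype.card V * ENNReal.ofReal ((31 / 32) ^ P.r) + (S.size k - 1 : ℕ) * q) := by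
      rw [← add_assoc, ← hq]
      conv_lhs => rw [← Nat.sub_add_cancel hpos]
      rw [Nat.cast_add, Nat.cast_one, add_mul, one_mul, add_comm]
    rw [hsplit]
    refine PMF.toOuterMeasure_bind_le_add ((sampleBuckets_le H γ N hθ k S).trans ?_)
      fun S₁ hS₁ hgood => ?_
    · gcongr
      exact hSm
    refine PMF.toOuterMeasure_bind_le_add (prune_stale_le P hV hrange ht H hγ S₁)
      fun S₂ hS₂ hprune => ?_
    simp only [Set.mem_ofPred_eq, not_exists, not_and, not_lt, not_not] at hgood hprune
    have hlt : S₂.size k < S.size k := lt_of_le_of_lt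
      (Finset.sum_le_sum fun i _ => Finset.card_le_card (prune_support hS₂ i)) (hdec S₁ hS₁)
    have hcontr : (S₂.size k : ℝ) ≤ (1 - θ) * S.size k := by
      rw [BatchState.size, BatchState.size, Nat.cast_sum, Nat.cast_sum, Finset.mul_sum]
      exact Finset.sum_le_sum fun i hi =>
        (Nat.cast_le.2 (Finset.card_le_card (hprune i))).trans (hgood i hi)
    refine (ih S₂ (hlt.le.trans hSm) ?_).trans ?_
    · refine lt_of_le_of_lt ?_ hT
      rw [pow_succ, mul_assoc]
      exact mul_le_mul_of_nonneg_left hcontr (pow_nonneg (by linarith) _)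
    · gcongr
      omega

theorem size_initialBuckets_le [Fintype V] (H : Dag V) (e : V → ℝ) (B : Finset V) (k : ℕ) :
    (BatchState.mk (initialBuckets H e) B).size k ≤ Fintype.card V := by
  rw [BatchState.size, ← Finset.card_biUnion]
  · exact Finset.card_le_univ _
  · have key : ∀ i j, 1 ≤ i → i < j → Disjoint (initialBuckets H e i) (initialBuckets H e j) := by
      intro i j hi hij
      rw [Finset.disjoint_left]
      intro v hv hv'
      have h1 := (Finset.mem_filter.1 hv).2.2
      have h2 := (Finset.mem_filter.1 hv').2.1.resolve_left (by omega)
      have h3 : (2 : ℝ) ^ (i + 1) ≤ 2 ^ j := pow_le_pow_right₀ (by norm_num) hij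
      linarith
    intro i hi j hj hij
    rcases Nat.lt_or_gt_of_ne hij with h | h
    · exact key i j (Finset.mem_Icc.1 hi).1 h
    · exact (key j i (Finset.mem_Icc.1 hj).1 h).symm

theorem findBatch_le [Fintype V] (P : EstimatorParams V) (hV : 2 ≤ Fintype.card V)
    (hrange : P.range = Fintype.card V ^ 3) (ht : 1952 ≤ P.t) (H : Dag V) {γ : ℝ} (hγ : 0 ≤ γ)
    {N : ℕ} (hN : 0 < N) {θ : ℝ} (hθ0 : 0 ≤ θ) (hθ : θ ≤ 1) (k T : ℕ)
    (hT : (1 - θ) ^ T * Fintype.card V < 1) :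
    (findBatch P H γ N k T).toOuterMeasure {R | ¬ AllEmpty k R} ≤
      ENNReal.ofReal (2 * (Fintype.card V : ℝ) ^ 2 * θ ^ N +
        4 * (Fintype.card V : ℝ) ^ 2 * (31 / 32) ^ P.r) := by
  rw [← zero_add (ENNReal.ofReal _)]
  -- No accuracy of the initial estimates is needed: whatever they are, the buckets are disjoint and
  -- hold at most `n` vertices.
  refine PMF.toOuterMeasure_bind_le_add (bad := ∅) (by simp) fun e _ _ => ?_
  have hsize := size_initialBuckets_le H e.2 ∅ k
  refine (whileLoop_le P hV hrange ht H hγ hN hθ k _ T _ hsize ?_).trans ?_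
  · refine lt_of_le_of_lt ?_ hT
    exact mul_le_mul_of_nonneg_left (Nat.cast_le.2 hsize) (pow_nonneg (by linarith) _)
  · refine (mul_le_mul_left (Nat.cast_le.2 hsize) _).trans_eq ?_
    have h2 : (2 : ℝ≥0∞) = ENNReal.ofReal 2 := by simp
    have h4 : (4 : ℝ≥0∞) = ENNReal.ofReal 4 := by simp
    have hpos : (0 : ℝ) ≤ Fintype.card V := Nat.cast_nonneg _
    rw [h2, h4, ← ENNReal.ofReal_natCast, ← ENNReal.ofReal_pow hθ0,
      ← ENNReal.ofReal_mul (by norm_num), ← ENNReal.ofReal_mul (by positivity),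
      ← ENNReal.ofReal_mul (by norm_num), ← ENNReal.ofReal_mul (by positivity),
      ← ENNReal.ofReal_add (by positivity) (by positivity), ← ENNReal.ofReal_mul (by positivity)]
    congr 1
    ring

end Sampling

/-! ### Numerical bounds and the choice of constants. -/

theorem pow_le_rpow_neg {n : ℕ} (hn : 2 ≤ n) {x b p q : ℝ} (hx : 0 ≤ x)
    (hxb : x ≤ Real.exp (-b)) (hb : 0 ≤ b) {m : ℕ} (hm : p * Real.log n ≤ m) (hq : q ≤ b * p) :
    x ^ m ≤ (n : ℝ) ^ (-q) := by
  have hn' : (2 : ℝ) ≤ n := by exact_mod_cast hn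
  have hlog : 0 ≤ Real.log n := Real.log_nonneg (by linarith)
  rw [Real.rpow_def_of_pos (by linarith)]
  refine (pow_le_pow_left₀ hx hxb m).trans ?_
  rw [← Real.exp_nat_mul]
  refine Real.exp_le_exp.2 ?_
  nlinarith [mul_le_mul_of_nonneg_left hm hb, mul_le_mul_of_nonneg_right hq hlog]

theorem failure_sum_le {n : ℕ} (hn : 2 ≤ n) {d x y : ℝ} (hx : x ≤ (n : ℝ) ^ (-(d + 6)))
    (hy : y ≤ (n : ℝ) ^ (-(d + 6))) :
    2 * (n : ℝ) ^ 2 * x + 4 * (n : ℝ) ^ 2 * y ≤ 1 / (n : ℝ) ^ d := by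
  have hn' : (2 : ℝ) ≤ n := by exact_mod_cast hn
  have hn0 : (0 : ℝ) < n := by linarith
  have hexp : (n : ℝ) ^ (-(d + 6)) = 1 / (n : ℝ) ^ d / (n : ℝ) ^ 6 := by
    rw [Real.rpow_neg hn0.le, Real.rpow_add hn0, mul_inv, one_div, div_eq_mul_inv]
    congr 2
    exact_mod_cast Real.rpow_natCast (n : ℝ) 6
  have hpos : (0 : ℝ) ≤ 1 / (n : ℝ) ^ d := by positivity
  have h6 : 6 * (n : ℝ) ^ 2 ≤ (n : ℝ) ^ 6 := by
    have h4 : (2 : ℝ) ^ 4 ≤ (n : ℝ) ^ 4 := pow_le_pow_left₀ (by norm_num) hn' 4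
    nlinarith [sq_nonneg (n : ℝ)]
  calc 2 * (n : ℝ) ^ 2 * x + 4 * (n : ℝ) ^ 2 * y
      ≤ 2 * (n : ℝ) ^ 2 * (n : ℝ) ^ (-(d + 6)) + 4 * (n : ℝ) ^ 2 * (n : ℝ) ^ (-(d + 6)) := by
        gcongr
    _ = 6 * (n : ℝ) ^ 2 / (n : ℝ) ^ 6 * (1 / (n : ℝ) ^ d) := by
        rw [hexp]
        ring
    _ ≤ 1 * (1 / (n : ℝ) ^ d) := by
        gcongr
        exact (div_le_one (by positivity)).2 h6
    _ = _ := one_mul _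

theorem one_sub_pow_mul_lt_one {n : ℕ} (hn : 2 ≤ n) {θ : ℝ} (hθ0 : 0 < θ) (hθ : θ ≤ 1) :
    (1 - θ) ^ ⌊(1 / θ + 2) * Real.log n⌋₊ * (n : ℝ) < 1 := by
  have hn' : (2 : ℝ) ≤ n := by exact_mod_cast hn
  have hn0 : (0 : ℝ) < n := by linarith
  have hlog : 1 / 2 < Real.log n :=
    lt_of_lt_of_le (by linarith [Real.log_two_gt_d9]) (Real.log_le_log (by norm_num) hn')
  set T := ⌊(1 / θ + 2) * Real.log n⌋₊
  have hT : (1 / θ + 2) * Real.log n < T + 1 := Nat.lt_floor_add_one _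
  -- The summand 2 in `1 / θ + 2` pays for rounding down, as `2 * Real.log n > 1`.
  have h1 : Real.log n < θ * T := by
    have h2 := mul_lt_mul_of_pos_left hT hθ0
    have h3 : θ * ((1 / θ + 2) * Real.log n) = Real.log n + 2 * θ * Real.log n := by
      field_simp
    nlinarith
  calc (1 - θ) ^ T * (n : ℝ) ≤ Real.exp (-θ) ^ T * n := by
        gcongr
        exact Real.one_sub_le_exp_neg θ
    _ = Real.exp (Real.log n - θ * T) := by
        rw [← Real.exp_nat_mul, sub_eq_add_neg, Real.exp_add, Real.exp_log hn0, mul_comm]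
        congr 2
        ring
    _ < 1 := Real.exp_lt_one_iff.2 (by linarith)

/-- `V` is the vertex set of the whole input graph, `n = |V|`, and `H` is a small subgraph. The
estimators have relative error `ε = 1/3`, so a sketch stores `t = c / ε ^ 2 = 9 * c` values from
`{1, …, n ^ 3}`; there are `⌈κ ln n⌉` hash functions; and a bucket is left after `N = ⌈a ln n⌉`
consecutive stale vertices. -/
theorem mainTheorem8 :
    ∃ c₀ : ℕ, ∀ c : ℕ, c₀ ≤ c →
    ∀ d : ℝ, 1 ≤ d →
    ∃ κ₀ : ℝ, ∀ κ : ℝ, κ₀ ≤ κ →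
    ∀ a : ℝ, 0 < a →
    ∃ C : ℝ, 0 < C ∧
      ∀ (V : Type*) [Fintype V] [DecidableEq V] (n : ℕ), n = Fintype.card V → 2 ≤ n →
      ∀ (ρ : ℕ), 1 < ρ →
      ∀ (H : Dag V), H.IsSmall ρ →
      ∀ (γ : ℝ), 0 < γ → γ < 1 / 2 →
      ∀ (hashV : HashFamily V (n ^ 3)) (hashE : HashFamily (V × V) (n ^ 3)),
        ENNReal.ofReal (1 - 1 / (n : ℝ) ^ d) ≤
          (findBatch ⟨9 * c, ⌈κ * Real.log n⌉₊, n ^ 3, hashV, hashE⟩ H γ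
              ⌈a * Real.log n⌉₊ (numBuckets ρ) ⌊C * Real.log n⌋₊).toOuterMeasure
            {S | AllEmpty (numBuckets ρ) S} := by
  -- The sketch size is then at least `9 * 217 = 1953 ≥ 1952`, and `31 / 32 ≤ exp (-1 / 32)` turns
  -- `κ ≥ 32 * (d + 6)` into `(31 / 32) ^ r ≤ n ^ (-(d + 6))`.
  refine ⟨217, fun c hc d hd => ⟨32 * (d + 6), fun κ hκ a ha => ?_⟩⟩
  -- For small `a` the runs of stale samples are short; `θ` is taken so small that `θ ^ N ≤ n ^ (-(d
  -- + 6))` still holds, at the price of the larger constant `1 / θ + 2`.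
  set θ : ℝ := Real.exp (-((d + 6) / a)) with hθ
  have hθ0 : 0 < θ := Real.exp_pos _
  have hda : 0 ≤ (d + 6) / a := by positivity
  have hθ1 : θ ≤ 1 := Real.exp_le_one_iff.2 (by linarith)
  refine ⟨1 / θ + 2, by positivity, ?_⟩
  intro V _ _ n hnV hn ρ _ H _ γ hγ _ hashV hashE
  have hn' : (1 : ℝ) < n := by exact_mod_cast hn
  have hlog : 0 < Real.log n := Real.log_pos hn'
  refine PMF.one_sub_le_toOuterMeasure _ _ (by positivity) ?_
  refine (findBatch_le _ (hnV ▸ hn) (hnV ▸ rfl) (by simp only; omega) H hγ.le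
    (Nat.ceil_pos.2 (mul_pos ha hlog)) hθ0.le hθ1 _ _
    (hnV ▸ one_sub_pow_mul_lt_one hn hθ0 hθ1)).trans ?_
  rw [← hnV]
  refine ENNReal.ofReal_le_ofReal (failure_sum_le hn ?_ ?_)
  · refine pow_le_rpow_neg hn hθ0.le le_rfl hda (Nat.le_ceil _) ?_
    rw [div_mul_cancel₀ _ ha.ne']
  · refine pow_le_rpow_neg hn (b := 1 / 32) (by norm_num) ?_ (by norm_num) (Nat.le_ceil _) ?_
    · exact le_trans (by norm_num) (Real.one_sub_le_exp_neg (1 / 32))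
    · linarith
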